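/- Let $Q$ be a smooth finite-dimensional manifold with projection $\pi\colon TQ\to Q$, and let $L\colon TQ\to\mathbf R$ be smooth. For a function $f$ on a vector bundle, $\mathrm Df$ denotes its fibre derivative (the derivative of $f$ along the fibres) and $\mathrm D^2f$ its fibre hessian. The Legendre map is ${\cal F}=\mathrm DL\colon TQ\to T^*Q$, and the energy is $E(v)=\langle \mathrm DL(v),v\rangle-L(v)$. Assume that $L$ is almost regular: $\cal F$ has connected fibres and is a submersion onto a closed (embedded) submanifold $P_0={\cal F}(TQ)$ of $T^*Q$. On an open set $O\subset T^*Q$ let the following be given: a hamiltonian $H$, that is, a smooth function with $H\circ{\cal F}=E$ on ${\cal F}^{-1}(O)$; and a finite independent set of primary hamiltonian constraints $\phi_\mu$, that is, smooth functions with $P_0\cap O=\{p\in O:\phi_\mu(p)=0\ \forall\mu\}$ whose differentials are linearly independent at the points of $P_0\cap O$. For a function $h$ on $O$ put $\gamma_h=\mathrm Dh\circ{\cal F}$, with values in $T^{**}Q\cong TQ$, and let $\Gamma_h=(\gamma_h)^{\rm v}$ be the corresponding vertical vector field on ${\cal F}^{-1}(O)$; write $\gamma_\mu=\gamma_{\phi_\mu}$,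 $\Gamma_\mu=\Gamma_{\phi_\mu}$. Here $(\cdot)^{\rm v}$ denotes the identifications $V_v(TQ)\cong T_{\pi(v)}Q$ and $V^*_v(TQ)\cong T^*_{\pi(v)}Q$ given by the vertical lift, where $V(TQ)=\ker T\pi$. A vector $X\in T_v(TQ)$ is of second order if $T\pi(X)=v$, and $N(TQ)$ is the set of these vectors. The Euler–Lagrange operator $\widehat{\delta L}\colon N(TQ)\to V^*(TQ)$ is, under these identifications and in natural coordinates $(q,v)$ of $TQ$, $$\widehat{\delta L}(X)=\Big(\frac{\partial L}{\partial q^i}-X\Big(\frac{\partial L}{\partial v^i}\Big)\Big)\,dq^i .$$ Let $V_1\subset TQ$ be the set of points $v$ for which there is a second-order vector $X\in T_v(TQ)$ with $\widehat{\delta L}(X)=0$. A primary dynamical field on an open set $U\subset TQ$ is a smooth second-order vector field $X$ on $U$ with $\widehat{\delta L}\circ X=0$ on $V_1\cap U$. Then there are smooth functions $\lambda^\mu$ on ${\cal F}^{-1}(O)$ such that $$ v=\gamma_H(v)+\sum_\mu\lambda^\mu(v)\,\gamma_\mu(v) \qquad (*)$$ for every $v\in{\cal F}^{-1}(O)$.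 Moreover, let $U\subset{\cal F}^{-1}(O)$ be open, let $\lambda^\mu$ be any smooth functions on $U$ satisfying $(*)$ on $U$, and let $\widehat{\cal M}\colon V^*(TQ)|_U\to V(TQ)|_U$ be the operator corresponding to $$M=(\mathrm D^2H\circ{\cal F})+\sum_\mu\lambda^\mu\,(\mathrm D^2\phi_\mu\circ{\cal F})\colon U\to\mathrm{Hom}(T^*Q,TQ).$$ Then for every smooth second-order vector field $X_0$ on $U$, the field $$D_0=X_0+\widehat{\cal M}\circ(\widehat{\delta L}\circ X_0)$$ is a primary dynamical field on $U$. More precisely, with $\chi_\mu=\langle\widehat{\delta L}\circ X_0,\Gamma_\mu\rangle$, one has on $U$ $$\widehat{\delta L}\circ D_0=\sum_\mu\chi_\mu\,(\mathrm D\lambda^\mu)^{\rm v},$$ and the right-hand side vanishes on $V_1\cap U$. -/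

import Mathlib

open Bundle Set
open scoped Manifold ContDiff Topology

namespace SingularLagrangian

noncomputable section

/-! ### The tangent and cotangent bundles of a manifold `Q` modelled on `E` -/

section Bundles

variable (E : Type*) [NormedAddCommGroup E] [NormedSpace ℝ E]
  (Q : Type*) [TopologicalSpace Q] [ChartedSpace E Q]

/-- The tangent bundle `TQ`. -/
abbrev TQ := TangentBundle 𝓘(ℝ, E) Q

/-- The cotangent bundle `T*Q`. -/
abbrev CoTQ [IsManifold 𝓘(ℝ, E) ∞ Q] :=
  TotalSpace (E →L[ℝ] ℝ) (fun q : Q => TangentSpace 𝓘(ℝ, E) q →L[ℝ] ℝ)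

/-- The model with corners of `TQ`. -/
abbrev modelTQ : ModelWithCorners ℝ (E × E) (ModelProd E E) := 𝓘(ℝ, E).tangent

/-- The model with corners of `T*Q`. -/
abbrev modelCoTQ : ModelWithCorners ℝ (E × (E →L[ℝ] ℝ)) (ModelProd E (E →L[ℝ] ℝ)) :=
  𝓘(ℝ, E).prod 𝓘(ℝ, E →L[ℝ] ℝ)

end Bundles

/-! ### Embedded submanifolds -/

section Submanifolds

variable {G : Type*} [NormedAddCommGroup G] [NormedSpace ℝ G]
  {K : Type*} [TopologicalSpace K] (J : ModelWithCorners ℝ G K)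
  {N : Type*} [TopologicalSpace N] [ChartedSpace K N]

/-- The differential of a real function at a point, as a covector. -/
def differential (f : N → ℝ) (p : N) : TangentSpace J p →L[ℝ] ℝ :=
  mfderiv J 𝓘(ℝ, ℝ) f p

/-- `S` is an embedded submanifold of `N`: near each of its points, it is the zero set of a
submersion to some `ℝᵐ`. -/
def IsEmbeddedSubmanifold (S : Set N) : Prop :=
  ∀ p ∈ S, ∃ (O : Set N) (m : ℕ) (f : N → EuclideanSpace ℝ (Fin m)),
    IsOpen O ∧ p ∈ O ∧ ContMDiffOn J 𝓘(ℝ, EuclideanSpace ℝ (Fin m)) ∞ f O ∧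
    S ∩ O = {x ∈ O | f x = 0} ∧
    ∀ x ∈ S ∩ O, Function.Surjective (mfderiv J 𝓘(ℝ, EuclideanSpace ℝ (Fin m)) f x)

/-- The tangent space at `p` of an embedded submanifold `S` of `N`, as a subspace of `T_p N`:
the vectors that annihilate every smooth function defined near `p` and vanishing on `S`. -/
def tangentSubspace (S : Set N) (p : N) : Submodule ℝ (TangentSpace J p) where
  carrier := {X | ∀ (O : Set N) (f : N → ℝ), IsOpen O → p ∈ O →
    ContMDiffOn J 𝓘(ℝ, ℝ) ∞ f O → (∀ x ∈ S ∩ O, f x = 0) → differential J f p X = 0}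
  zero_mem' := fun _ _ _ _ _ _ => map_zero _
  add_mem' := fun hX hY O f h₁ h₂ h₃ h₄ => by
    rw [map_add, hX O f h₁ h₂ h₃ h₄, hY O f h₁ h₂ h₃ h₄, add_zero]
  smul_mem' := fun c X hX O f h₁ h₂ h₃ h₄ => by
    rw [map_smul, hX O f h₁ h₂ h₃ h₄, smul_zero]

end Submanifolds

variable {E : Type*} [NormedAddCommGroup E] [NormedSpace ℝ E]
  {Q : Type*} [TopologicalSpace Q] [ChartedSpace E Q] [IsManifold 𝓘(ℝ, E) ∞ Q]

/-! ### Vertical vectors and the vertical lift on `TQ` -/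

/-- The inclusion of the fibre `T_q Q` in `TQ`. -/
def fibreIncl (q : Q) (w : E) : TQ E Q := ⟨q, w⟩

theorem hasMFDerivAt_proj (v : TQ E Q) :
    HasMFDerivAt (modelTQ E) 𝓘(ℝ, E) (TotalSpace.proj : TQ E Q → Q) v
      (ContinuousLinearMap.fst ℝ E E) := by
  refine ⟨(FiberBundle.continuous_proj E (TangentSpace 𝓘(ℝ, E))).continuousAt, ?_⟩
  have h : HasFDerivWithinAt (Prod.fst : E × E → E) (ContinuousLinearMap.fst ℝ E E)
    (range (modelTQ E)) (extChartAt (modelTQ E) v v) := hasFDerivAt_fst.hasFDerivWithinAt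
  have key : ∀ z ∈ (extChartAt (modelTQ E) v).target,
      writtenInExtChartAt (modelTQ E) 𝓘(ℝ, E) v (TotalSpace.proj : TQ E Q → Q) z = z.1 := by
    intro z hz
    have hz' : z ∈ (chartAt (ModelProd E E) v).target := by
      rw [extChartAt_target] at hz
      exact hz.1
    have h1 : z.1 ∈ (chartAt E v.proj).target := (TangentBundle.mem_chart_target_iff z v).1 hz'
    have h2 := TangentBundle.coe_chartAt_symm_fst (I := 𝓘(ℝ, E)) z v
    change (chartAt E v.proj) ((chartAt (ModelProd E E) v).symm z).proj = z.1
    rw [h2, (chartAt E v.proj).right_inv h1]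
  refine h.congr_of_eventuallyEq ?_ ?_
  · filter_upwards [extChartAt_target_mem_nhdsWithin (I := modelTQ E) v] with z hz
    exact key z hz
  · exact key _ (mem_extChartAt_target v)

theorem hasMFDerivAt_fibreIncl (q : Q) (w : E) :
    HasMFDerivAt 𝓘(ℝ, E) (modelTQ E) (fibreIncl (E := E) q) w
      (ContinuousLinearMap.inr ℝ E E) := by
  have hc : Continuous (fibreIncl (E := E) q) :=
    (FiberBundle.totalSpaceMk_isInducing E (TangentSpace 𝓘(ℝ, E)) q).continuous
  refine ⟨hc.continuousAt, ?_⟩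
  have h : HasFDerivWithinAt (fun u : E => ((chartAt E q q, u) : E × E))
    (ContinuousLinearMap.inr ℝ E E) (range 𝓘(ℝ, E)) (extChartAt 𝓘(ℝ, E) w w) :=
      (hasFDerivAt_prodMk_right _ _).hasFDerivWithinAt
  have key : ∀ u : E, writtenInExtChartAt 𝓘(ℝ, E) (modelTQ E) w (fibreIncl (E := E) q) u =
      ((chartAt E q q, u) : E × E) := by
    intro u
    change (chartAt (ModelProd E E) (fibreIncl (E := E) q w)) (fibreIncl (E := E) q u) = _
    refine Prod.ext (TangentBundle.coe_chartAt_fst (I := 𝓘(ℝ, E)) _ _) ?_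
    exact tangentCoordChange_self (I := 𝓘(ℝ, E)) (x := q) (z := q) (v := u)
      (mem_extChartAt_source q)
  exact h.congr_of_eventuallyEq (Filter.Eventually.of_forall key) (key _)

/-- The vertical tangent space `V_v(TQ)`: the kernel of the tangent map of `TQ → Q` at `v`. -/
def verticalSpace (v : TQ E Q) : Submodule ℝ (TangentSpace (modelTQ E) v) :=
  (mfderiv (modelTQ E) 𝓘(ℝ, E) (TotalSpace.proj : TQ E Q → Q) v).ker

/-- The tangent map at `w` of the inclusion of the fibre `T_q Q` in `TQ`. -/
def fibreInclDeriv (q : Q) (w : E) : E →L[ℝ] TangentSpace (modelTQ E) (fibreIncl q w) :=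
  mfderiv 𝓘(ℝ, E) (modelTQ E) (fibreIncl (E := E) q) w

theorem fibreInclDeriv_apply (q : Q) (w u : E) :
    (fibreInclDeriv q w u : E × E) = (0, u) := by
  rw [fibreInclDeriv, (hasMFDerivAt_fibreIncl q w).mfderiv]
  rfl

theorem mem_verticalSpace (v : TQ E Q) (X : TangentSpace (modelTQ E) v) :
    X ∈ verticalSpace v ↔ (X : E × E).1 = 0 := by
  rw [verticalSpace, LinearMap.mem_ker, (hasMFDerivAt_proj v).mfderiv]
  rfl

/-- The vertical lift `T_q Q ≃ V_v(TQ)` at `v ∈ T_q Q`: the tangent map at `v` of the inclusion of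
the fibre `T_q Q` in `TQ`; that is, `w` is sent to the velocity at `t = 0` of `v + t w`. -/
def verticalLift (v : TQ E Q) : TangentSpace 𝓘(ℝ, E) v.proj ≃ₗ[ℝ] verticalSpace v :=
  LinearEquiv.ofBijective
    (LinearMap.codRestrict (verticalSpace v) (fibreInclDeriv (E := E) v.proj v.2).toLinearMap
      (fun w => (mem_verticalSpace v _).2
        (congrArg Prod.fst (fibreInclDeriv_apply (E := E) v.proj v.2 w))))
    (by
      constructor
      · intro w w' h
        have h' : (fibreInclDeriv (E := E) v.proj v.2 w : E × E) = fibreInclDeriv (E := E) v.proj v.2 w' :=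
          congrArg Subtype.val h
        have h'' : ((0, w) : E × E) = (0, w') :=
          (fibreInclDeriv_apply (E := E) v.proj v.2 w).symm.trans
            (h'.trans (fibreInclDeriv_apply (E := E) v.proj v.2 w'))
        exact congrArg Prod.snd h''
      · rintro ⟨X, hX⟩
        rw [mem_verticalSpace] at hX
        refine ⟨(X : E × E).2, Subtype.ext ?_⟩
        exact (fibreInclDeriv_apply (E := E) v.proj v.2 (X : E × E).2).trans (Prod.ext hX.symm rfl))

/-- The section `α^v` of `V*(TQ)` given by a covector `α ∈ T*_q Q` at `v ∈ T_q Q`. -/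
def verticalCovector (v : TQ E Q) (α : TangentSpace 𝓘(ℝ, E) v.proj →L[ℝ] ℝ) :
    Module.Dual ℝ (verticalSpace v) :=
  α.toLinearMap ∘ₗ (verticalLift v).symm.toLinearMap

/-! ### Fibre derivatives -/

/-- The fibre derivative `Df : TQ → T*Q` of a function `f` on `TQ`. -/
def fibreDeriv (f : TQ E Q → ℝ) (v : TQ E Q) : TangentSpace 𝓘(ℝ, E) v.proj →L[ℝ] ℝ :=
  (fderiv ℝ (fun w : E => f ⟨v.proj, w⟩) v.2 : E →L[ℝ] ℝ)

/-- The Legendre map `DL : TQ → T*Q`. -/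
def legendre (L : TQ E Q → ℝ) (v : TQ E Q) : CoTQ E Q := ⟨v.proj, fibreDeriv L v⟩

/-- The energy of `L`, `v ↦ ⟨DL(v), v⟩ - L(v)`. -/
def energy (L : TQ E Q → ℝ) (v : TQ E Q) : ℝ := fibreDeriv L v v.2 - L v

/-- The canonical isomorphism of a finite-dimensional space with its bidual. -/
def bidualEquiv [FiniteDimensional ℝ E] : E ≃ₗ[ℝ] ((E →L[ℝ] ℝ) →L[ℝ] ℝ) :=
  LinearEquiv.ofBijective (NormedSpace.inclusionInDoubleDual ℝ E).toLinearMap (by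
    have hinj : Function.Injective (NormedSpace.inclusionInDoubleDual ℝ E).toLinearMap :=
      (NormedSpace.inclusionInDoubleDualLi (E := E) ℝ).injective
    have h1 : ∀ (V : Type _) [NormedAddCommGroup V] [NormedSpace ℝ V] [FiniteDimensional ℝ V],
        Module.finrank ℝ (V →L[ℝ] ℝ) = Module.finrank ℝ V := fun V _ _ _ =>
      (LinearMap.toContinuousLinearMap (𝕜 := ℝ) (E := V) (F' := ℝ)).finrank_eq.symm.trans
        Subspace.dual_finrank_eq
    exact ⟨hinj, (LinearMap.injective_iff_surjective_of_finrank_eq_finrank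
      (by rw [h1, h1])).1 hinj⟩)

/-- The fibre derivative of a function `h` on `T*Q`, as a map `T*Q → T**Q ≃ TQ`. -/
def coFibreDeriv [FiniteDimensional ℝ E] (h : CoTQ E Q → ℝ) (p : CoTQ E Q) :
    TangentSpace 𝓘(ℝ, E) p.proj :=
  (bidualEquiv (E := E)).symm (fderiv ℝ (fun β : E →L[ℝ] ℝ => h ⟨p.proj, β⟩) p.2)

/-- The fibre hessian of a function `h` on `T*Q`, as a map `T*Q → Hom(T*Q, TQ)`. -/
def coFibreHessian [FiniteDimensional ℝ E] (h : CoTQ E Q → ℝ) (p : CoTQ E Q) :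
    (TangentSpace 𝓘(ℝ, E) p.proj →L[ℝ] ℝ) →L[ℝ] TangentSpace 𝓘(ℝ, E) p.proj :=
  (fderiv ℝ (fun β : E →L[ℝ] ℝ => (coFibreDeriv h ⟨p.proj, β⟩ : E)) p.2 :
    (E →L[ℝ] ℝ) →L[ℝ] E)

/-- The map `γ_h = Dh ∘ DL : TQ → TQ`. -/
def gam [FiniteDimensional ℝ E] (L : TQ E Q → ℝ) (h : CoTQ E Q → ℝ) (v : TQ E Q) :
    TangentSpace 𝓘(ℝ, E) v.proj :=
  coFibreDeriv h (legendre L v)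

/-- The vertical vector field `Γ_h = γ_h^v` on `TQ`. -/
def Gam [FiniteDimensional ℝ E] (L : TQ E Q → ℝ) (h : CoTQ E Q → ℝ) (v : TQ E Q) :
    verticalSpace v :=
  verticalLift v (gam L h v)

/-! ### Almost regular lagrangians, hamiltonians and primary hamiltonian constraints -/

/-- `L` is almost regular: its Legendre map is a submersion onto a closed submanifold of `T*Q`,
with connected fibres. -/
structure AlmostRegular (L : TQ E Q → ℝ) : Prop where
  isClosed : IsClosed (range (legendre L))
  submanifold : IsEmbeddedSubmanifold (modelCoTQ E) (range (legendre L))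
  submersion : ∀ v, (mfderiv (modelTQ E) (modelCoTQ E) (legendre L) v).range =
    tangentSubspace (modelCoTQ E) (range (legendre L)) (legendre L v)
  connected : ∀ p ∈ range (legendre L), IsConnected (legendre L ⁻¹' {p})

/-- `H` is a hamiltonian for `L` on the open set `O` of `T*Q`: `H ∘ DL` is the energy. -/
structure IsHamiltonian (L : TQ E Q → ℝ) (O : Set (CoTQ E Q)) (H : CoTQ E Q → ℝ) : Prop where
  smooth : ContMDiffOn (modelCoTQ E) 𝓘(ℝ, ℝ) ∞ H O
  energy_eq : ∀ v, legendre L v ∈ O → energy L v = H (legendre L v)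

/-- The functions `φ μ` are an independent set of primary hamiltonian constraints on the open set
`O` of `T*Q`: their vanishing defines the image of the Legendre map in `O`, and their differentials
are linearly independent at its points. -/
structure IsIndependentPrimaryConstraints {ι : Type*} (L : TQ E Q → ℝ) (O : Set (CoTQ E Q))
    (φ : ι → CoTQ E Q → ℝ) : Prop where
  smooth : ∀ μ, ContMDiffOn (modelCoTQ E) 𝓘(ℝ, ℝ) ∞ (φ μ) O
  defines : range (legendre L) ∩ O = {p ∈ O | ∀ μ, φ μ p = 0}
  independent : ∀ p ∈ range (legendre L) ∩ O,
    LinearIndependent ℝ (fun μ => differential (modelCoTQ E) (φ μ) p)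

/-- The functions `lam μ` on the open set `U` of `TQ` resolve the identity of `TQ`:
`Id = γ_H + ∑ μ, lam μ γ_μ` on `U`. -/
structure IsResolution [FiniteDimensional ℝ E] {ι : Type*} [Fintype ι] (L : TQ E Q → ℝ)
    (H : CoTQ E Q → ℝ) (φ : ι → CoTQ E Q → ℝ) (U : Set (TQ E Q)) (lam : ι → TQ E Q → ℝ) :
    Prop where
  smooth : ∀ μ, ContMDiffOn (modelTQ E) 𝓘(ℝ, ℝ) ∞ (lam μ) U
  eq : ∀ v ∈ U, v.2 = gam L H v + ∑ μ, lam μ v • gam L (φ μ) v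

/-- The map `M = D²H ∘ DL + ∑ μ, lam μ (D²φ_μ ∘ DL)`, from `TQ` to `Hom(T*Q, TQ)`. -/
def M [FiniteDimensional ℝ E] {ι : Type*} [Fintype ι] (L : TQ E Q → ℝ)
    (H : CoTQ E Q → ℝ) (φ : ι → CoTQ E Q → ℝ) (lam : ι → TQ E Q → ℝ) (v : TQ E Q) :
    (TangentSpace 𝓘(ℝ, E) v.proj →L[ℝ] ℝ) →L[ℝ] TangentSpace 𝓘(ℝ, E) v.proj :=
  coFibreHessian H (legendre L v) + ∑ μ, lam μ v • coFibreHessian (φ μ) (legendre L v)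

/-- The operator `V*(TQ) → V(TQ)` corresponding to `M`. -/
def Mhat [FiniteDimensional ℝ E] {ι : Type*} [Fintype ι] (L : TQ E Q → ℝ)
    (H : CoTQ E Q → ℝ) (φ : ι → CoTQ E Q → ℝ) (lam : ι → TQ E Q → ℝ) (v : TQ E Q)
    (ξ : Module.Dual ℝ (verticalSpace v)) : verticalSpace v :=
  let α : E →ₗ[ℝ] ℝ := ξ ∘ₗ (verticalLift v).toLinearMap
  let α' : E →L[ℝ] ℝ := LinearMap.toContinuousLinearMap α
  verticalLift v (M L H φ lam v α')

/-! ### The Euler-Lagrange form and second-order vector fields -/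

/-- The set `N_v(TQ)` of the tangent vectors at `v ∈ TQ` that satisfy the second-order condition
`T(π) X = v`, where `π : TQ → Q`. -/
def secondOrderVectors (v : TQ E Q) : Set (TangentSpace (modelTQ E) v) :=
  {X | mfderiv (modelTQ E) 𝓘(ℝ, E) (TotalSpace.proj : TQ E Q → Q) v X = v.2}

/-- The local expression of `L` in the chart of `TQ` induced by the chart of `Q` at the base point
of `v`. -/
def localLagrangian (L : TQ E Q → ℝ) (v : TQ E Q) (z : E × E) : ℝ :=
  L ((extChartAt (modelTQ E) v).symm z)

/-- The Euler-Lagrange form on a second-order tangent vector `X` at `v ∈ T_q Q`. In the natural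
coordinates `(x, u)` of `TQ` induced by the chart of `Q` at `q`, it is
`(∂L/∂xⁱ - X(∂L/∂uⁱ)) dxⁱ`. -/
def eulerLagrange (L : TQ E Q → ℝ) (v : TQ E Q) (X : TangentSpace (modelTQ E) v) :
    TangentSpace 𝓘(ℝ, E) v.proj →L[ℝ] ℝ :=
  let z : E × E := extChartAt (modelTQ E) v v
  let X' : E × E := mfderiv (modelTQ E) 𝓘(ℝ, E × E) (extChartAt (modelTQ E) v) v X
  let dx : TangentSpace 𝓘(ℝ, E) v.proj →L[ℝ] E :=
    mfderiv 𝓘(ℝ, E) 𝓘(ℝ, E) (extChartAt 𝓘(ℝ, E) v.proj) v.proj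
  ((fderiv ℝ (localLagrangian L v) z).comp (ContinuousLinearMap.inl ℝ E E) -
    fderiv ℝ (fun y : E × E =>
      (fderiv ℝ (localLagrangian L v) y).comp (ContinuousLinearMap.inr ℝ E E)) z X').comp dx

/-- The Euler-Lagrange form as a map `N(TQ) → V*(TQ)`. -/
def eulerLagrangeHat (L : TQ E Q → ℝ) (v : TQ E Q) (X : TangentSpace (modelTQ E) v) :
    Module.Dual ℝ (verticalSpace v) :=
  verticalCovector v (eulerLagrange L v X)

/-- `X` is a (smooth) second-order vector field on the open set `U` of `TQ`. -/
structure IsSecondOrderField (U : Set (TQ E Q)) (X : ∀ v : TQ E Q, TangentSpace (modelTQ E) v) :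
    Prop where
  smooth : ContMDiffOn (modelTQ E) (modelTQ E).tangent ∞
    (fun v => (⟨v, X v⟩ : TangentBundle (modelTQ E) (TQ E Q))) U
  secondOrder : ∀ v ∈ U, X v ∈ secondOrderVectors v

/-- The primary lagrangian constraint subset `V₁` of `TQ`: the points at which the Euler-Lagrange
form vanishes on some second-order tangent vector. -/
def primaryLagrangianSubset (L : TQ E Q → ℝ) : Set (TQ E Q) :=
  {v | ∃ X ∈ secondOrderVectors v, eulerLagrangeHat L v X = 0}

/-- `X` is a primary dynamical field of `L` on the open set `U` of `TQ`: a second-order vector field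
satisfying the Euler-Lagrange equation on `V₁`. -/
structure IsPrimaryField (L : TQ E Q → ℝ) (U : Set (TQ E Q))
    (X : ∀ v : TQ E Q, TangentSpace (modelTQ E) v) : Prop where
  field : IsSecondOrderField U X
  eulerLagrange_eq : ∀ v ∈ primaryLagrangianSubset L ∩ U, eulerLagrangeHat L v (X v) = 0

/-- The primary lagrangian constraint `⟨δL ∘ X₀, Γ_φ⟩` given by a second-order vector field `X₀` and
a primary hamiltonian constraint `φ`. -/
def chi [FiniteDimensional ℝ E] (L : TQ E Q → ℝ) (φ : CoTQ E Q → ℝ)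
    (X₀ : ∀ v : TQ E Q, TangentSpace (modelTQ E) v) (v : TQ E Q) : ℝ :=
  eulerLagrangeHat L v (X₀ v) (Gam L φ v)

/-- The vector field `D₀ = X₀ + M ∘ (δL ∘ X₀)`. -/
def D₀ [FiniteDimensional ℝ E] {ι : Type*} [Fintype ι] (L : TQ E Q → ℝ)
    (H : CoTQ E Q → ℝ) (φ : ι → CoTQ E Q → ℝ) (lam : ι → TQ E Q → ℝ)
    (X₀ : ∀ v : TQ E Q, TangentSpace (modelTQ E) v) (v : TQ E Q) : TangentSpace (modelTQ E) v :=
  X₀ v + (Mhat L H φ lam v (eulerLagrangeHat L v (X₀ v)) : TangentSpace (modelTQ E) v)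

end

end SingularLagrangian

open SingularLagrangian

namespace SingularLagrangian

noncomputable section

variable {E : Type*} [NormedAddCommGroup E] [NormedSpace ℝ E]
  {Q : Type*} [TopologicalSpace Q] [ChartedSpace E Q] [IsManifold 𝓘(ℝ, E) ∞ Q]

/-! ### Natural coordinates on `TQ` and `T*Q` -/

/-! Write `W` for the fibre hessian of `L`. Two second-order vectors at a point differ by a vertical
vector `u`, and adding `u` changes the Euler-Lagrange form by `-W u` (`elForm_add_vertical`). The
theorem is therefore about `W`, its kernel, and a partial inverse of it.

The kernel comes from the Legendre map `F`. Differentiating `φ_μ ∘ F = 0` along the fibres gives `W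
γ_μ = 0`; differentiating `H ∘ F = E` gives `W (v - γ_H) = 0` (`hessSnd_apply_constraint`,
`hessSnd_apply_hamiltonian`). Conversely, a covector `β` annihilating every `γ_μ` is a vertical
vector tangent to the image of `F`, so by the submersion hypothesis it has the form `W w`
(`exists_hessSnd_eq`). By duality the kernel of `W` is spanned by the `γ_μ` (`mem_span_dCo`), hence
`v - γ_H` is a combination of them. The `γ_μ` are independent (`linearIndependent_dCo`), which makes
the coefficients smooth (`contDiffAt_coefficients`).

Differentiating the resolution `v = γ_H + ∑ λ^μ γ_μ` along the fibres gives `Id = M W + ∑ γ_μ ⊗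
Dλ^μ`. Since `M` and `W` are symmetric, the transpose reads `α - W M α = ∑ α(γ_μ) Dλ^μ`
(`sub_hessSnd_resolution`). With `α` the Euler-Lagrange form of `X₀`, the left side is the form of
`X₀ + M α`, that is, of `D₀`: this is the asserted formula. At a point of `V₁` some second-order
vector has vanishing form, so `α` lies in the image of `W` and annihilates each `γ_μ`; all `χ_μ`
vanish there (`modelEL_modelGam_eq_zero`).

The rest is the passage to natural coordinates. A tangent vector at `q` is stored through the
preferred chart at `q`, which need not vary continuously with `q`. Pointwise identities can use that
chart, but derivatives and smoothness need one fixed chart, hence the frames `toFrame`, `ofFrame`,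
`toFrameTQ` and the coordinate independence of the Euler-Lagrange form (`elForm_tangentLift`). -/

/-- The components in the chart at `q₀` of a tangent vector at `q`. -/
def toFrame (q₀ q : Q) : E →L[ℝ] E := tangentCoordChange 𝓘(ℝ, E) q q₀ q

/-- The tangent vector at `q` with given components in the chart at `q₀`. -/
def ofFrame (q₀ q : Q) : E →L[ℝ] E := tangentCoordChange 𝓘(ℝ, E) q₀ q q

theorem toFrame_ofFrame {q₀ q : Q} (hq : q ∈ (chartAt E q₀).source) (u : E) :
    toFrame q₀ q (ofFrame q₀ q u) = u := by
  have h1 : q ∈ (extChartAt 𝓘(ℝ, E) q₀).source := by rwa [extChartAt_source]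
  have h2 : q ∈ (extChartAt 𝓘(ℝ, E) q).source := mem_extChartAt_source q
  rw [toFrame, ofFrame, tangentCoordChange_comp ⟨⟨h1, h2⟩, h1⟩, tangentCoordChange_self h1]

theorem ofFrame_toFrame {q₀ q : Q} (hq : q ∈ (chartAt E q₀).source) (u : E) :
    ofFrame q₀ q (toFrame q₀ q u) = u := by
  have h1 : q ∈ (extChartAt 𝓘(ℝ, E) q₀).source := by rwa [extChartAt_source]
  have h2 : q ∈ (extChartAt 𝓘(ℝ, E) q).source := mem_extChartAt_source q
  rw [toFrame, ofFrame, tangentCoordChange_comp ⟨⟨h2, h1⟩, h2⟩, tangentCoordChange_self h2]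

theorem toFrame_self (q : Q) : toFrame q q = ContinuousLinearMap.id ℝ E :=
  ContinuousLinearMap.ext fun _ => tangentCoordChange_self (mem_extChartAt_source q)

theorem ofFrame_self (q : Q) : ofFrame q q = ContinuousLinearMap.id ℝ E :=
  ContinuousLinearMap.ext fun _ => tangentCoordChange_self (mem_extChartAt_source q)

/-- A tangent vector as an element of the model space. -/
def vec (v : TQ E Q) : E := v.2

/-- A covector as an element of the dual of the model space. -/
def covec (p : CoTQ E Q) : E →L[ℝ] ℝ := p.2

/-- The covector at `q` given by a linear form on the model space. -/
def coIncl (q : Q) (β : E →L[ℝ] ℝ) : CoTQ E Q := ⟨q, β⟩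

/-- The natural chart of `TQ` induced by the chart of `Q` at `q₀`. -/
def tqChart (q₀ : Q) : PartialEquiv (TQ E Q) (E × E) :=
  extChartAt (modelTQ E) (fibreIncl q₀ (0 : E))

theorem mem_tqChart_source {q₀ : Q} {v : TQ E Q} :
    v ∈ (tqChart q₀).source ↔ v.proj ∈ (chartAt E q₀).source := by
  rw [tqChart, extChartAt_source, TangentBundle.mem_chart_source_iff]
  rfl

theorem mem_tqChart_target {q₀ : Q} {z : E × E} :
    z ∈ (tqChart (Q := Q) q₀).target ↔ z.1 ∈ (chartAt E q₀).target := by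
  rw [tqChart, extChartAt_target, (modelTQ E).range_eq_univ, inter_univ]
  exact TangentBundle.mem_chart_target_iff (I := 𝓘(ℝ, E)) z (fibreIncl q₀ (0 : E))

theorem tqChart_apply (q₀ : Q) (v : TQ E Q) :
    tqChart q₀ v = (chartAt E q₀ v.proj, toFrame q₀ v.proj (vec v)) := rfl

theorem tqChart_symm_apply {q₀ : Q} {z : E × E} (hz : z.1 ∈ (chartAt E q₀).target) :
    (tqChart q₀).symm z =
      fibreIncl ((chartAt E q₀).symm z.1) (ofFrame q₀ ((chartAt E q₀).symm z.1) z.2) := by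
  have hs := (chartAt E q₀).map_target hz
  refine (tqChart q₀).injOn ((tqChart q₀).map_target (mem_tqChart_target.2 hz))
    (mem_tqChart_source.2 hs) ?_
  rw [(tqChart q₀).right_inv (mem_tqChart_target.2 hz), tqChart_apply]
  refine Prod.ext ((chartAt E q₀).right_inv hz).symm (toFrame_ofFrame hs _).symm

/-- The natural chart of `T*Q` induced by the chart of `Q` at `q₀`. -/
def coChart (q₀ : Q) : PartialEquiv (CoTQ E Q) (E × (E →L[ℝ] ℝ)) :=
  extChartAt (modelCoTQ E) (coIncl q₀ (0 : E →L[ℝ] ℝ))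

theorem mem_coChart_source {q₀ : Q} {p : CoTQ E Q} :
    p ∈ (coChart q₀).source ↔ p.proj ∈ (chartAt E q₀).source := by
  rw [coChart, extChartAt_source, FiberBundle.chartedSpace_chartAt]
  simp only [mfld_simps, coIncl]
  constructor
  · exact fun h => h.1.1
  · exact fun h => ⟨⟨h, trivial⟩, h⟩

/-- The trivialization of a bundle of linear maps conjugates by the trivializations of source and
target. The target here is the trivial line bundle, so only precomposition with the frame of `TQ`
remains. -/
theorem coChart_apply {q₀ : Q} {p : CoTQ E Q} (hp : p.proj ∈ (chartAt E q₀).source) :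
    coChart q₀ p = (chartAt E q₀ p.proj, (covec p).comp (ofFrame q₀ p.proj)) := by
  refine Prod.ext rfl ?_
  have h := TangentBundle.symmL_trivializationAt_eq_core (I := 𝓘(ℝ, E)) hp
  refine ContinuousLinearMap.ext fun u => ?_
  have h' := DFunLike.congr_fun h u
  refine Eq.trans ?_ (congrArg (covec p) h')
  have h2 := Bundle.Trivial.continuousLinearMapAt_trivialization ℝ Q ℝ p.proj
  exact DFunLike.congr_fun h2 _

theorem mem_coChart_target {q₀ : Q} {z : E × (E →L[ℝ] ℝ)} :
    z ∈ (coChart (Q := Q) q₀).target ↔ z.1 ∈ (chartAt E q₀).target := by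
  rw [coChart, extChartAt_target, FiberBundle.chartedSpace_chartAt, (modelCoTQ E).range_eq_univ,
    inter_univ]
  simp only [mfld_simps, coIncl]
  constructor
  · exact fun h => h.1.1
  · exact fun h => ⟨⟨h, trivial⟩, (chartAt E q₀).map_target h, trivial⟩

theorem isOpen_tqChart_target (q₀ : Q) : IsOpen (tqChart (E := E) q₀).target :=
  isOpen_extChartAt_target _

theorem isOpen_coChart_target (q₀ : Q) : IsOpen (coChart (E := E) q₀).target :=
  isOpen_extChartAt_target _

theorem contMDiffOn_tqChart (q₀ : Q) :
    ContMDiffOn (modelTQ E) 𝓘(ℝ, E × E) ∞ (tqChart q₀) (tqChart (E := E) q₀).source := by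
  rw [tqChart, extChartAt_source]
  exact contMDiffOn_extChartAt

theorem contMDiffOn_tqChart_symm (q₀ : Q) :
    ContMDiffOn 𝓘(ℝ, E × E) (modelTQ E) ∞ (tqChart q₀).symm (tqChart (E := E) q₀).target :=
  contMDiffOn_extChartAt_symm _

theorem contMDiffOn_coChart_symm (q₀ : Q) :
    ContMDiffOn 𝓘(ℝ, E × (E →L[ℝ] ℝ)) (modelCoTQ E) ∞ (coChart q₀).symm
      (coChart (E := E) q₀).target :=
  contMDiffOn_extChartAt_symm _

/-! ### Local expressions of functions -/

/-- The local expression of a function on `TQ` in the natural chart at `q₀`. -/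
def loc (f : TQ E Q → ℝ) (q₀ : Q) (z : E × E) : ℝ := f ((tqChart q₀).symm z)

/-- The local expression of a function on `T*Q` in the natural chart at `q₀`. -/
def coLoc (h : CoTQ E Q → ℝ) (q₀ : Q) (z : E × (E →L[ℝ] ℝ)) : ℝ := h ((coChart q₀).symm z)

theorem loc_apply (f : TQ E Q → ℝ) {q₀ q : Q} (hq : q ∈ (chartAt E q₀).source) (w : E) :
    loc f q₀ (chartAt E q₀ q, toFrame q₀ q w) = f (fibreIncl q w) :=
  congrArg f ((tqChart q₀).left_inv (x := fibreIncl q w) (mem_tqChart_source.2 hq))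

theorem coLoc_apply (h : CoTQ E Q → ℝ) {q₀ q : Q} (hq : q ∈ (chartAt E q₀).source)
    (β : E →L[ℝ] ℝ) :
    coLoc h q₀ (chartAt E q₀ q, β.comp (ofFrame q₀ q)) = h (coIncl q β) := by
  have h1 := (coChart q₀).left_inv (x := coIncl q β) (mem_coChart_source.2 hq)
  rw [coChart_apply hq] at h1
  exact congrArg h h1

theorem contDiffAt_loc {f : TQ E Q → ℝ} {U : Set (TQ E Q)} (hU : IsOpen U)
    (hf : ContMDiffOn (modelTQ E) 𝓘(ℝ, ℝ) ∞ f U) {q₀ : Q} {z : E × E}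
    (hz : z ∈ (tqChart (Q := Q) q₀).target) (hzU : (tqChart q₀).symm z ∈ U) :
    ContDiffAt ℝ ∞ (loc f q₀) z :=
  ((hf.contMDiffAt (hU.mem_nhds hzU)).comp z ((contMDiffOn_tqChart_symm q₀).contMDiffAt
    ((isOpen_tqChart_target q₀).mem_nhds hz))).contDiffAt

theorem contDiffAt_coLoc {h : CoTQ E Q → ℝ} {O : Set (CoTQ E Q)} (hO : IsOpen O)
    (hh : ContMDiffOn (modelCoTQ E) 𝓘(ℝ, ℝ) ∞ h O) {q₀ : Q} {z : E × (E →L[ℝ] ℝ)}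
    (hz : z ∈ (coChart (Q := Q) q₀).target) (hzO : (coChart q₀).symm z ∈ O) :
    ContDiffAt ℝ ∞ (coLoc h q₀) z :=
  ((hh.contMDiffAt (hO.mem_nhds hzO)).comp z ((contMDiffOn_coChart_symm q₀).contMDiffAt
    ((isOpen_coChart_target q₀).mem_nhds hz))).contDiffAt

/-! ### Calculus in the model spaces -/

/-- The derivative of a function on a product in the second variable. -/
def dSnd {F : Type*} [NormedAddCommGroup F] [NormedSpace ℝ F] (f : E × F → ℝ) (z : E × F) :
    F →L[ℝ] ℝ :=
  (fderiv ℝ f z).comp (ContinuousLinearMap.inr ℝ E F)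

theorem dSnd_apply {F : Type*} [NormedAddCommGroup F] [NormedSpace ℝ F] (f : E × F → ℝ)
    (z : E × F) (u : F) : dSnd f z u = fderiv ℝ f z (0, u) := rfl

theorem ContDiffAt.dSnd {F : Type*} [NormedAddCommGroup F] [NormedSpace ℝ F] {f : E × F → ℝ}
    {z : E × F} (hf : ContDiffAt ℝ ∞ f z) : ContDiffAt ℝ ∞ (dSnd f) z :=
  (hf.fderiv_right (m := ∞) le_rfl).clm_comp contDiffAt_const

theorem _root_.ContDiffAt.differentiableAt_top {F G : Type*} [NormedAddCommGroup F]
    [NormedSpace ℝ F] [NormedAddCommGroup G] [NormedSpace ℝ G] {f : F → G} {z : F}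
    (hf : ContDiffAt ℝ ∞ f z) : DifferentiableAt ℝ f z :=
  hf.differentiableAt (by simp)

theorem _root_.ContDiffAt.eventually_top {F G : Type*} [NormedAddCommGroup F]
    [NormedSpace ℝ F] [NormedAddCommGroup G] [NormedSpace ℝ G] {f : F → G} {z : F}
    (hf : ContDiffAt ℝ ∞ f z) : ∀ᶠ y in 𝓝 z, DifferentiableAt ℝ f y :=
  ((hf.of_le (m := 1) (by simp)).eventually (by simp)).mono fun _ hy => hy.differentiableAt (by simp)

theorem two_le_top : (2 : WithTop ℕ∞) ≤ ∞ := WithTop.coe_le_coe.2 (le_top : (2 : ℕ∞) ≤ ⊤)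

/-- The Euler-Lagrange form of a function on `E × E`. -/
def elForm (f : E × E → ℝ) (z X : E × E) : E →L[ℝ] ℝ :=
  (fderiv ℝ f z).comp (ContinuousLinearMap.inl ℝ E E) - fderiv ℝ (dSnd f) z X

/-- The tangent map of a map of `E`, as a map of `E × E`. -/
def tangentLift (ψ : E → E) (z : E × E) : E × E := (ψ z.1, fderiv ℝ ψ z.1 z.2)

/-- The product rule for `fderiv ℝ ψ z.1 z.2` produces the second derivative of `ψ`, the one
non-tensorial term in a change of natural coordinates. -/
theorem hasFDerivAt_tangentLift {ψ : E → E} {z : E × E} (hψ : ContDiffAt ℝ 2 ψ z.1) :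
    HasFDerivAt (tangentLift ψ)
      (((fderiv ℝ ψ z.1).comp (ContinuousLinearMap.fst ℝ E E)).prod
        (((fderiv ℝ (fderiv ℝ ψ) z.1).flip z.2).comp (ContinuousLinearMap.fst ℝ E E) +
          (fderiv ℝ ψ z.1).comp (ContinuousLinearMap.snd ℝ E E))) z := by
  have h1 : HasFDerivAt (fun y : E × E => ψ y.1)
      ((fderiv ℝ ψ z.1).comp (ContinuousLinearMap.fst ℝ E E)) z :=
    (hψ.differentiableAt (by simp)).hasFDerivAt.comp z hasFDerivAt_fst
  have h2 : HasFDerivAt (fun y : E × E => fderiv ℝ ψ y.1)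
      ((fderiv ℝ (fderiv ℝ ψ) z.1).comp (ContinuousLinearMap.fst ℝ E E)) z :=
    ((hψ.fderiv_right (m := 1) (by norm_num)).differentiableAt (by simp)).hasFDerivAt.comp z hasFDerivAt_fst
  have h3 := h2.clm_apply (hasFDerivAt_snd (𝕜 := ℝ) (E := E) (F := E) (p := z))
  refine (h1.prodMk h3).congr_fderiv ?_
  ext u <;> simp

theorem contDiffAt_tangentLift {ψ : E → E} {z : E × E} (hψ : ContDiffAt ℝ ∞ ψ z.1) :
    ContDiffAt ℝ ∞ (tangentLift ψ) z := by
  have h1 : ContDiffAt ℝ ∞ (fun y : E × E => ψ y.1) z := hψ.comp z contDiffAt_fst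
  have h2 : ContDiffAt ℝ ∞ (fun y : E × E => fderiv ℝ ψ y.1) z :=
    (hψ.fderiv_right (m := ∞) le_rfl).comp z contDiffAt_fst
  exact h1.prodMk (h2.clm_apply contDiffAt_snd)

/-- The Euler-Lagrange form does not depend on the coordinates, on second-order vectors. -/
theorem elForm_tangentLift {ψ : E → E} {f g : E × E → ℝ} {z : E × E}
    (hψ : ContDiffAt ℝ ∞ ψ z.1) (hg : ContDiffAt ℝ ∞ g (tangentLift ψ z))
    (hf : f =ᶠ[𝓝 z] g ∘ tangentLift ψ) (w a : E) :
    elForm f z (z.2, w) a =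
      elForm g (tangentLift ψ z) (fderiv ℝ (tangentLift ψ) z (z.2, w)) (fderiv ℝ ψ z.1 a) := by
  have hψ2 : ContDiffAt ℝ 2 ψ z.1 := hψ.of_le two_le_top
  have hψ1 : ∀ᶠ y in 𝓝 z, ContDiffAt ℝ 2 ψ y.1 ∧ DifferentiableAt ℝ g (tangentLift ψ y) := by
    refine Filter.Eventually.and ?_ ?_
    · exact continuousAt_fst.eventually (hψ2.eventually (by simp))
    · exact (contDiffAt_tangentLift hψ).continuousAt.eventually hg.eventually_top
  have hder : ∀ᶠ y in 𝓝 z, fderiv ℝ f y =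
      (fderiv ℝ g (tangentLift ψ y)).comp (fderiv ℝ (tangentLift ψ) y) := by
    filter_upwards [hψ1, hf.eventuallyEq_nhds] with y hy hfy
    rw [hfy.fderiv_eq, fderiv_comp y hy.2 (hasFDerivAt_tangentLift hy.1).differentiableAt]
  -- A base coordinate change acts linearly on each fibre, so the fibre derivative transforms as a
  -- covector on a whole neighbourhood and can be differentiated again.
  have hdS : dSnd f =ᶠ[𝓝 z] fun y => (dSnd g (tangentLift ψ y)).comp (fderiv ℝ ψ y.1) := by
    filter_upwards [hψ1, hder] with y hy hdy
    ext b
    simp [dSnd, hdy, (hasFDerivAt_tangentLift hy.1).fderiv]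
  -- The `x`-derivative of `f` along `a` contributes the second derivative of `ψ` at `(a, z.2)`, and
  -- the derivative of `dSnd f` contributes it at `(z.2, a)`. They cancel by symmetry precisely
  -- because the first component of the vector is `z.2`.
  have hsymm : ∀ x y, fderiv ℝ (fderiv ℝ ψ) z.1 x y = fderiv ℝ (fderiv ℝ ψ) z.1 y x :=
    fun x y => (hψ2.isSymmSndFDerivAt (by simp)).eq x y
  have h2 : HasFDerivAt (fun y : E × E => fderiv ℝ ψ y.1)
      ((fderiv ℝ (fderiv ℝ ψ) z.1).comp (ContinuousLinearMap.fst ℝ E E)) z :=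
    (hψ.fderiv_right (m := ∞) le_rfl).differentiableAt_top.hasFDerivAt.comp z hasFDerivAt_fst
  have h3 : HasFDerivAt (fun y => dSnd g (tangentLift ψ y)) _ z :=
    hg.dSnd.differentiableAt_top.hasFDerivAt.comp z (hasFDerivAt_tangentLift hψ2)
  have h4 := (h3.clm_comp h2).fderiv
  rw [elForm, elForm, hder.self_of_nhds, hdS.fderiv_eq, h4, (hasFDerivAt_tangentLift hψ2).fderiv]
  have h5 : ∀ b c : E, fderiv ℝ g (tangentLift ψ z) (b, c) =
    fderiv ℝ g (tangentLift ψ z) (b, 0) + fderiv ℝ g (tangentLift ψ z) (0, c) := fun b c => by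
      rw [← map_add]; simp
  simp [dSnd_apply]
  rw [h5, hsymm]
  ring

/-! ### Fibre derivatives and the Legendre map in coordinates -/

theorem fibreDeriv_eq_dSnd {f : TQ E Q → ℝ} {q₀ : Q} {v : TQ E Q}
    (hq : v.proj ∈ (chartAt E q₀).source) (hf : DifferentiableAt ℝ (loc f q₀) (tqChart q₀ v)) :
    fibreDeriv f v = (dSnd (loc f q₀) (tqChart q₀ v)).comp (toFrame q₀ v.proj) := by
  have h1 : (fun w : E => f ⟨v.proj, w⟩) =
      fun w => loc f q₀ (chartAt E q₀ v.proj, toFrame q₀ v.proj w) :=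
    funext fun w => (loc_apply f hq w).symm
  have h2 : HasFDerivAt (fun w : E => (chartAt E q₀ v.proj, toFrame q₀ v.proj w))
      ((0 : E →L[ℝ] E).prod (toFrame q₀ v.proj)) (vec v) :=
    (hasFDerivAt_const _ _).prodMk (toFrame q₀ v.proj).hasFDerivAt
  have h3 : HasFDerivAt (fun w => loc f q₀ (chartAt E q₀ v.proj, toFrame q₀ v.proj w)) _ (vec v) :=
    HasFDerivAt.comp (g := loc f q₀) (vec v) hf.hasFDerivAt h2
  rw [← h1] at h3
  refine h3.fderiv.trans ?_
  ext w
  rfl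

/-- The Legendre map in coordinates. -/
def locLegendre (f : E × E → ℝ) (z : E × E) : E × (E →L[ℝ] ℝ) := (z.1, dSnd f z)

theorem contDiffAt_locLegendre {f : E × E → ℝ} {z : E × E} (hf : ContDiffAt ℝ ∞ f z) :
    ContDiffAt ℝ ∞ (locLegendre f) z :=
  contDiffAt_fst.prodMk hf.dSnd

theorem contDiffAt_loc_of_contMDiff {L : TQ E Q → ℝ} (hL : ContMDiff (modelTQ E) 𝓘(ℝ, ℝ) ∞ L)
    {q₀ : Q} {z : E × E} (hz : z ∈ (tqChart (Q := Q) q₀).target) :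
    ContDiffAt ℝ ∞ (loc L q₀) z :=
  contDiffAt_loc isOpen_univ hL.contMDiffOn hz (mem_univ _)

theorem coChart_legendre {L : TQ E Q → ℝ} (hL : ContMDiff (modelTQ E) 𝓘(ℝ, ℝ) ∞ L)
    {q₀ : Q} {v : TQ E Q} (hq : v.proj ∈ (chartAt E q₀).source) :
    coChart q₀ (legendre L v) = locLegendre (loc L q₀) (tqChart q₀ v) := by
  rw [coChart_apply (p := legendre L v) hq]
  refine Prod.ext rfl ?_
  have h := fibreDeriv_eq_dSnd (f := L) hq (contDiffAt_loc_of_contMDiff hL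
    ((tqChart q₀).map_source (mem_tqChart_source.2 hq))).differentiableAt_top
  ext u
  refine (DFunLike.congr_fun h (ofFrame q₀ v.proj u)).trans ?_
  exact congrArg (dSnd (loc L q₀) (tqChart q₀ v)) (toFrame_ofFrame hq u)

theorem legendre_tqChart_symm {L : TQ E Q → ℝ} (hL : ContMDiff (modelTQ E) 𝓘(ℝ, ℝ) ∞ L)
    {q₀ : Q} {z : E × E} (hz : z ∈ (tqChart (Q := Q) q₀).target) :
    legendre L ((tqChart q₀).symm z) = (coChart q₀).symm (locLegendre (loc L q₀) z) := by
  have h1 := (tqChart q₀).map_target hz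
  have h2 : ((tqChart q₀).symm z).proj ∈ (chartAt E q₀).source := mem_tqChart_source.1 h1
  rw [← (coChart q₀).left_inv (x := legendre L ((tqChart q₀).symm z)) (mem_coChart_source.2 h2),
    coChart_legendre hL h2, (tqChart q₀).right_inv hz]

theorem contMDiff_legendre {L : TQ E Q → ℝ} (hL : ContMDiff (modelTQ E) 𝓘(ℝ, ℝ) ∞ L) :
    ContMDiff (modelTQ E) (modelCoTQ E) ∞ (legendre L) := by
  intro v
  have hv : v ∈ (tqChart v.proj).source := mem_tqChart_source.2 (mem_chart_source E v.proj)
  have hz := (tqChart v.proj).map_source hv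
  have ho : IsOpen (tqChart (E := E) v.proj).source := isOpen_extChartAt_source _
  have h1 : ContMDiffAt (modelTQ E) 𝓘(ℝ, E × E) ∞ (tqChart v.proj) v :=
    (contMDiffOn_tqChart v.proj).contMDiffAt (ho.mem_nhds hv)
  have h2 : ContMDiffAt 𝓘(ℝ, E × E) 𝓘(ℝ, E × (E →L[ℝ] ℝ)) ∞ (locLegendre (loc L v.proj))
      (tqChart v.proj v) :=
    (contDiffAt_locLegendre (contDiffAt_loc_of_contMDiff hL hz)).contMDiffAt
  have h3 : ContMDiffAt 𝓘(ℝ, E × (E →L[ℝ] ℝ)) (modelCoTQ E) ∞ (coChart v.proj).symm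
      (locLegendre (loc L v.proj) (tqChart v.proj v)) :=
    (contMDiffOn_coChart_symm v.proj).contMDiffAt
      ((isOpen_coChart_target v.proj).mem_nhds (mem_coChart_target.2 (mem_tqChart_target.1 hz)))
  refine ((h3.comp v (h2.comp v h1))).congr_of_eventuallyEq ?_
  filter_upwards [ho.mem_nhds hv] with y hy
  have := legendre_tqChart_symm hL ((tqChart v.proj).map_source hy)
  rwa [(tqChart v.proj).left_inv hy] at this

/-- The preferred charts at `v` and at its image are both induced by the chart at `v.proj`, so the
manifold derivative is the ordinary derivative of the local expression, without change of frame. -/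
theorem mfderiv_legendre {L : TQ E Q → ℝ} (hL : ContMDiff (modelTQ E) 𝓘(ℝ, ℝ) ∞ L) (v : TQ E Q) :
    mfderiv (modelTQ E) (modelCoTQ E) (legendre L) v =
      fderiv ℝ (locLegendre (loc L v.proj)) (tqChart v.proj v) := by
  have hv : v ∈ (tqChart v.proj).source := mem_tqChart_source.2 (mem_chart_source E v.proj)
  have hz := (tqChart v.proj).map_source hv
  rw [((contMDiff_legendre hL).mdifferentiable (by simp) v).mfderiv]
  have h : writtenInExtChartAt (modelTQ E) (modelCoTQ E) v (legendre L) =ᶠ[𝓝 (tqChart v.proj v)]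
      locLegendre (loc L v.proj) := by
    filter_upwards [(isOpen_tqChart_target v.proj).mem_nhds hz] with z hz
    change coChart v.proj (legendre L ((tqChart v.proj).symm z)) = _
    rw [legendre_tqChart_symm hL hz, (coChart v.proj).right_inv]
    exact mem_coChart_target.2 (mem_tqChart_target.1 hz)
  rw [(modelTQ E).range_eq_univ, fderivWithin_univ]
  exact h.fderiv_eq

theorem differential_eq_fderiv {h : CoTQ E Q → ℝ} {O : Set (CoTQ E Q)} (hO : IsOpen O)
    (hh : ContMDiffOn (modelCoTQ E) 𝓘(ℝ, ℝ) ∞ h O) {p : CoTQ E Q} (hp : p ∈ O) :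
    differential (modelCoTQ E) h p = fderiv ℝ (coLoc h p.proj) (coChart p.proj p) := by
  rw [differential, ((hh.contMDiffAt (hO.mem_nhds hp)).mdifferentiableAt (by simp)).mfderiv,
    (modelCoTQ E).range_eq_univ, fderivWithin_univ]
  rfl

/-! ### The Euler-Lagrange form in coordinates -/

/-- Tangent vectors at `x` are by convention recorded in the preferred chart at `x`, so the
derivative of that chart is the identity. -/
theorem mfderiv_extChartAt_self {G : Type*} [NormedAddCommGroup G] [NormedSpace ℝ G]
    {K : Type*} [TopologicalSpace K] (J : ModelWithCorners ℝ G K) [J.Boundaryless]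
    {N : Type*} [TopologicalSpace N] [ChartedSpace K N] [IsManifold J 1 N] (x : N) (X : G) :
    (mfderiv J 𝓘(ℝ, G) (extChartAt J x) x X : G) = X := by
  have h : writtenInExtChartAt J 𝓘(ℝ, G) x (extChartAt J x) =ᶠ[𝓝 (extChartAt J x x)] id := by
    filter_upwards [(isOpen_extChartAt_target x).mem_nhds (mem_extChartAt_target x)] with z hz
    exact (extChartAt J x).right_inv hz
  rw [(mdifferentiableAt_extChartAt (mem_chart_source K x)).mfderiv, J.range_eq_univ,
    fderivWithin_univ, h.fderiv_eq, fderiv_id]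
  rfl

theorem eulerLagrange_eq_elForm (L : TQ E Q → ℝ) (v : TQ E Q) (X : TangentSpace (modelTQ E) v) :
    eulerLagrange L v X = elForm (loc L v.proj) (tqChart v.proj v) X := by
  have h1 : (mfderiv (modelTQ E) 𝓘(ℝ, E × E) (extChartAt (modelTQ E) v) v X : E × E) = X := by
    exact mfderiv_extChartAt_self (G := E × E) _ v X
  have h2 : ∀ u : E, (mfderiv 𝓘(ℝ, E) 𝓘(ℝ, E) (extChartAt 𝓘(ℝ, E) v.proj) v.proj u : E) = u := by
    exact mfderiv_extChartAt_self (G := E) _ v.proj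
  ext u
  simp only [eulerLagrange]
  rw [h1]
  exact congrArg (elForm (loc L v.proj) (tqChart v.proj v) X) (h2 u)

/-! ### Changes of natural coordinates -/

/-- The change of coordinates from the chart of `Q` at `q` to the chart at `q₀`. -/
def baseChange (q q₀ : Q) (x : E) : E := chartAt E q₀ ((chartAt E q).symm x)

theorem contDiffAt_baseChange {q q₀ : Q} {x : E} (hx : x ∈ (chartAt E q).target)
    (hx' : (chartAt E q).symm x ∈ (chartAt E q₀).source) :
    ContDiffAt ℝ ∞ (baseChange q q₀) x := by
  have h1 : ContMDiffAt 𝓘(ℝ, E) 𝓘(ℝ, E) ∞ (chartAt E q).symm x :=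
    (contMDiffOn_chart_symm (I := 𝓘(ℝ, E)) (n := ∞) (x := q)).contMDiffAt
      ((chartAt E q).open_target.mem_nhds hx)
  have h2 : ContMDiffAt 𝓘(ℝ, E) 𝓘(ℝ, E) ∞ (chartAt E q₀) ((chartAt E q).symm x) :=
    (contMDiffOn_chart (I := 𝓘(ℝ, E)) (n := ∞) (x := q₀)).contMDiffAt
      ((chartAt E q₀).open_source.mem_nhds hx')
  exact (h2.comp x h1).contDiffAt

theorem tangentCoordChange_eq_fderiv (q q₀ q' : Q) :
    tangentCoordChange 𝓘(ℝ, E) q q₀ q' = fderiv ℝ (baseChange q q₀) (chartAt E q q') := by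
  rw [tangentCoordChange_def, modelWithCornersSelf_coe, range_id, fderivWithin_univ]
  rfl

theorem toFrame_eq_fderiv (q₀ q : Q) :
    toFrame q₀ q = fderiv ℝ (baseChange q q₀) (chartAt E q q) :=
  tangentCoordChange_eq_fderiv q q₀ q

/-- The fibre part is the cocycle rule for coordinate changes: passing through the preferred chart
at the point itself leaves the direct change from `q` to `q₀`. -/
theorem tqChart_comp_symm {q q₀ : Q} {z : E × E} (hz : z.1 ∈ (chartAt E q).target)
    (hz' : (chartAt E q).symm z.1 ∈ (chartAt E q₀).source) :
    tqChart q₀ ((tqChart q).symm z) = tangentLift (baseChange q q₀) z := by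
  rw [tqChart_symm_apply hz, tqChart_apply]
  refine Prod.ext rfl ?_
  have h := tangentCoordChange_eq_fderiv (E := E) q q₀ ((chartAt E q).symm z.1)
  rw [(chartAt E q).right_inv hz] at h
  have h1 : (chartAt E q).symm z.1 ∈ (extChartAt 𝓘(ℝ, E) q₀).source := by rwa [extChartAt_source]
  have h2 : (chartAt E q).symm z.1 ∈ (extChartAt 𝓘(ℝ, E) q).source := by
    rw [extChartAt_source]; exact (chartAt E q).map_target hz
  have h3 : (chartAt E q).symm z.1 ∈ (extChartAt 𝓘(ℝ, E) ((chartAt E q).symm z.1)).source :=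
    mem_extChartAt_source _
  exact (tangentCoordChange_comp (v := z.2) ⟨⟨h2, h3⟩, h1⟩).trans (DFunLike.congr_fun h z.2)

theorem eventually_tqChart_comp_symm {q₀ : Q} {v : TQ E Q}
    (hq : v.proj ∈ (chartAt E q₀).source) :
    ∀ᶠ z in 𝓝 (tqChart v.proj v), z ∈ (tqChart v.proj).target ∧
      (tqChart v.proj).symm z ∈ (tqChart q₀).source ∧
      tqChart q₀ ((tqChart v.proj).symm z) = tangentLift (baseChange v.proj q₀) z := by
  have hx : (tqChart v.proj v).1 ∈ (chartAt E v.proj).target := mem_chart_target E v.proj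
  have h1 : ∀ᶠ x in 𝓝 (tqChart v.proj v).1, x ∈ (chartAt E v.proj).target ∧
      (chartAt E v.proj).symm x ∈ (chartAt E q₀).source := by
    refine Filter.Eventually.and ((chartAt E v.proj).open_target.mem_nhds hx) ?_
    refine ((chartAt E v.proj).symm.continuousAt hx).eventually
      ((chartAt E q₀).open_source.mem_nhds ?_)
    simpa [tqChart_apply] using hq
  filter_upwards [continuousAt_fst.eventually h1] with z hz
  refine ⟨mem_tqChart_target.2 hz.1, ?_, tqChart_comp_symm hz.1 hz.2⟩
  rw [tqChart_symm_apply hz.1]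
  exact mem_tqChart_source.2 hz.2

/-- The components in the natural chart at `q₀` of a tangent vector of `TQ` at `v`. -/
def toFrameTQ (q₀ : Q) (v : TQ E Q) : E × E →L[ℝ] E × E :=
  tangentCoordChange (modelTQ E) v (fibreIncl q₀ (0 : E)) v

theorem toFrameTQ_eq_fderiv {q₀ : Q} {v : TQ E Q} (hq : v.proj ∈ (chartAt E q₀).source) :
    toFrameTQ q₀ v = fderiv ℝ (tangentLift (baseChange v.proj q₀)) (tqChart v.proj v) := by
  rw [toFrameTQ, tangentCoordChange_def, (modelTQ E).range_eq_univ, fderivWithin_univ]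
  exact Filter.EventuallyEq.fderiv_eq ((eventually_tqChart_comp_symm hq).mono fun z hz => hz.2.2)

theorem contDiffAt_baseChange_proj {q₀ q : Q} (hq : q ∈ (chartAt E q₀).source) :
    ContDiffAt ℝ ∞ (baseChange q q₀) (chartAt E q q) :=
  contDiffAt_baseChange (mem_chart_target E q) (by simpa using hq)

/-- The second derivative of the base change is paired with the base component of the vector, which
is zero here. -/
theorem toFrameTQ_vertical {q₀ : Q} {v : TQ E Q} (hq : v.proj ∈ (chartAt E q₀).source) (w : E) :
    toFrameTQ q₀ v (0, w) = (0, toFrame q₀ v.proj w) := by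
  have h : ContDiffAt ℝ ∞ (baseChange v.proj q₀) (tqChart v.proj v).1 :=
    contDiffAt_baseChange_proj hq
  rw [toFrameTQ_eq_fderiv hq, toFrame_eq_fderiv,
    (hasFDerivAt_tangentLift (h.of_le two_le_top)).fderiv]
  simp [tqChart_apply]

/-- The Euler-Lagrange form of a second-order vector, in the natural chart at `q₀`. -/
theorem eulerLagrange_eq_elForm_toFrame {L : TQ E Q → ℝ}
    (hL : ContMDiff (modelTQ E) 𝓘(ℝ, ℝ) ∞ L) {q₀ : Q} {v : TQ E Q}
    (hq : v.proj ∈ (chartAt E q₀).source) (X : E × E) (hX : X.1 = vec v) (a : E) :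
    (eulerLagrange L v X : E →L[ℝ] ℝ) a =
      elForm (loc L q₀) (tqChart q₀ v) (toFrameTQ q₀ v X) (toFrame q₀ v.proj a) := by
  have hev := eventually_tqChart_comp_symm hq
  have hv : v ∈ (tqChart v.proj).source := mem_tqChart_source.2 (mem_chart_source E v.proj)
  have h0 : tangentLift (baseChange v.proj q₀) (tqChart v.proj v) = tqChart q₀ v := by
    rw [← hev.self_of_nhds.2.2, (tqChart v.proj).left_inv hv]
  have hz : tqChart q₀ v ∈ (tqChart q₀).target :=
    (tqChart q₀).map_source (mem_tqChart_source.2 hq)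
  have hf : loc L v.proj =ᶠ[𝓝 (tqChart v.proj v)]
      loc L q₀ ∘ tangentLift (baseChange v.proj q₀) := by
    filter_upwards [hev] with z hz
    rw [Function.comp_apply, ← hz.2.2, loc, loc, (tqChart q₀).left_inv hz.2.1]
  -- The second-order condition in the shape needed by `elForm_tangentLift`: the frame at the base
  -- point of `v` is the identity, so the fibre coordinate of `v` is `vec v`.
  have hX' : X = ((tqChart v.proj v).2, X.2) := by
    refine Prod.ext ?_ rfl
    rw [hX, tqChart_apply, toFrame_self]
    rfl
  refine (DFunLike.congr_fun (eulerLagrange_eq_elForm L v X) a).trans ?_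
  rw [hX', toFrameTQ_eq_fderiv hq, toFrame_eq_fderiv, ← h0]
  exact elForm_tangentLift (contDiffAt_baseChange_proj hq)
    (by rw [h0]; exact contDiffAt_loc_of_contMDiff hL hz) hf X.2 a

/-! ### Fibre derivatives of functions on `E × E*` -/

instance instNormedAddCommGroupBidual : NormedAddCommGroup ((E →L[ℝ] ℝ) →L[ℝ] ℝ) :=
  ContinuousLinearMap.toNormedAddCommGroup

instance instNormedSpaceBidual : NormedSpace ℝ ((E →L[ℝ] ℝ) →L[ℝ] ℝ) :=
  ContinuousLinearMap.toNormedSpace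

theorem apply_bidualEquiv_symm [FiniteDimensional ℝ E] (ψ : (E →L[ℝ] ℝ) →L[ℝ] ℝ) (β : E →L[ℝ] ℝ) :
    β ((bidualEquiv (E := E)).symm ψ) = ψ β := by
  conv_rhs => rw [← (bidualEquiv (E := E)).apply_symm_apply ψ]
  rfl

theorem eq_of_forall_dual [FiniteDimensional ℝ E] {u w : E} (h : ∀ β : E →L[ℝ] ℝ, β u = β w) :
    u = w :=
  (bidualEquiv (E := E)).injective (ContinuousLinearMap.ext h)

/-- The canonical isomorphism of a finite-dimensional space with its bidual, as a homeomorphism. -/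
def bidualCLE [FiniteDimensional ℝ E] : E ≃L[ℝ] ((E →L[ℝ] ℝ) →L[ℝ] ℝ) :=
  LinearEquiv.toContinuousLinearEquiv (𝕜 := ℝ) (E := E) (F := (E →L[ℝ] ℝ) →L[ℝ] ℝ)
    (bidualEquiv (E := E))

/-- The derivative of a function on `E × E*` in the second variable, as an element of `E`. -/
def dCo [FiniteDimensional ℝ E] (h : E × (E →L[ℝ] ℝ) → ℝ) (y : E × (E →L[ℝ] ℝ)) : E :=
  (bidualEquiv (E := E)).symm (dSnd h y)

theorem apply_dCo [FiniteDimensional ℝ E] (h : E × (E →L[ℝ] ℝ) → ℝ) (y : E × (E →L[ℝ] ℝ))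
    (β : E →L[ℝ] ℝ) : β (dCo h y) = fderiv ℝ h y (0, β) :=
  apply_bidualEquiv_symm _ _

theorem contDiffAt_dCo [FiniteDimensional ℝ E] {h : E × (E →L[ℝ] ℝ) → ℝ}
    {y : E × (E →L[ℝ] ℝ)} (hh : ContDiffAt ℝ ∞ h y) : ContDiffAt ℝ ∞ (dCo h) y :=
  ContDiffAt.comp y (ContinuousLinearEquiv.contDiff (F := E) (bidualCLE (E := E)).symm).contDiffAt
    hh.dSnd

/-- The hessian of a function on `E × E*` in the second variable, as a map `E* → E`. -/
def hessCo [FiniteDimensional ℝ E] (h : E × (E →L[ℝ] ℝ) → ℝ) (y : E × (E →L[ℝ] ℝ)) :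
    (E →L[ℝ] ℝ) →L[ℝ] E :=
  (fderiv ℝ (dCo h) y).comp (ContinuousLinearMap.inr ℝ E (E →L[ℝ] ℝ))

theorem contDiffAt_hessCo [FiniteDimensional ℝ E] {h : E × (E →L[ℝ] ℝ) → ℝ}
    {y : E × (E →L[ℝ] ℝ)} (hh : ContDiffAt ℝ ∞ h y) : ContDiffAt ℝ ∞ (hessCo h) y :=
  ((contDiffAt_dCo hh).fderiv_right (m := ∞) le_rfl).clm_comp contDiffAt_const

/-- The hessian of a function on `E × E` in the second variable, as a map `E → E*`. -/
def hessSnd (f : E × E → ℝ) (z : E × E) : E →L[ℝ] E →L[ℝ] ℝ :=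
  (fderiv ℝ (dSnd f) z).comp (ContinuousLinearMap.inr ℝ E E)

/-- `dSnd` is the full derivative composed with a constant inclusion. Partial hessians are thus
restrictions of the second derivative and inherit its symmetry. -/
theorem fderiv_dSnd {F : Type*} [NormedAddCommGroup F] [NormedSpace ℝ F] {f : E × F → ℝ}
    {z : E × F} (hf : ContDiffAt ℝ ∞ f z) (X : E × F) (w : F) :
    fderiv ℝ (dSnd f) z X w = fderiv ℝ (fderiv ℝ f) z X (0, w) := by
  have h := ((hf.fderiv_right (m := ∞) le_rfl).differentiableAt_top.hasFDerivAt).clm_comp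
    (hasFDerivAt_const (ContinuousLinearMap.inr ℝ E F) z)
  have h' : fderiv ℝ (dSnd f) z = _ := h.fderiv
  rw [h']
  simp

theorem hessSnd_symm {f : E × E → ℝ} {z : E × E} (hf : ContDiffAt ℝ ∞ f z) (u w : E) :
    hessSnd f z u w = hessSnd f z w u := by
  have h := ((hf.of_le two_le_top).isSymmSndFDerivAt (by simp)).eq (0, u) (0, w)
  rw [← fderiv_dSnd hf, ← fderiv_dSnd hf] at h
  exact h

theorem apply_hessCo [FiniteDimensional ℝ E] {h : E × (E →L[ℝ] ℝ) → ℝ}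
    {y : E × (E →L[ℝ] ℝ)} (hh : ContDiffAt ℝ ∞ h y) (α β : E →L[ℝ] ℝ) :
    β (hessCo h y α) = fderiv ℝ (fderiv ℝ h) y (0, α) (0, β) := by
  rw [← fderiv_dSnd hh]
  have h1 : HasFDerivAt (dCo h)
      (((bidualCLE (E := E)).symm : _ →L[ℝ] E).comp (fderiv ℝ (dSnd h) y)) y :=
    (bidualCLE (E := E)).symm.hasFDerivAt.comp y hh.dSnd.differentiableAt_top.hasFDerivAt
  rw [hessCo, h1.fderiv]
  exact apply_bidualEquiv_symm _ β

theorem hessCo_symm [FiniteDimensional ℝ E] {h : E × (E →L[ℝ] ℝ) → ℝ}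
    {y : E × (E →L[ℝ] ℝ)} (hh : ContDiffAt ℝ ∞ h y) (α β : E →L[ℝ] ℝ) :
    β (hessCo h y α) = α (hessCo h y β) := by
  rw [apply_hessCo hh, apply_hessCo hh]
  exact ((hh.of_le two_le_top).isSymmSndFDerivAt (by simp)).eq (0, α) (0, β)

/-! ### Local consequences of the definitions of hamiltonians and constraints -/

theorem hasFDerivAt_locLegendre {f : E × E → ℝ} {z : E × E} (hf : ContDiffAt ℝ ∞ f z) :
    HasFDerivAt (locLegendre f)
      ((ContinuousLinearMap.fst ℝ E E).prod (fderiv ℝ (dSnd f) z)) z :=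
  hasFDerivAt_fst.prodMk hf.dSnd.differentiableAt_top.hasFDerivAt

/-- Chain rule for a function that vanishes along the Legendre map: its differential kills every
vector tangent to the image. -/
theorem fderiv_constraint_locLegendre {f : E × E → ℝ} {z : E × E} (hf : ContDiffAt ℝ ∞ f z)
    {φ : E × (E →L[ℝ] ℝ) → ℝ} (hφ : ContDiffAt ℝ ∞ φ (locLegendre f z))
    (h : ∀ᶠ z' in 𝓝 z, φ (locLegendre f z') = 0) (X : E × E) :
    fderiv ℝ φ (locLegendre f z) (X.1, fderiv ℝ (dSnd f) z X) = 0 := by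
  have h1 := (hφ.differentiableAt_top.hasFDerivAt.comp z (hasFDerivAt_locLegendre hf)).fderiv
  have h2 : fderiv ℝ (φ ∘ locLegendre f) z = 0 := by
    have h3 : φ ∘ locLegendre f =ᶠ[𝓝 z] fun _ => (0 : ℝ) := h
    rw [h3.fderiv_eq, fderiv_fun_const]
    rfl
  rw [h2] at h1
  exact (DFunLike.congr_fun h1 X).symm

/-- The case of a vertical vector, where the differential of `φ` is evaluated through its fibre
derivative. -/
theorem hessSnd_apply_constraint [FiniteDimensional ℝ E] {f : E × E → ℝ} {z : E × E}
    (hf : ContDiffAt ℝ ∞ f z)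
    {φ : E × (E →L[ℝ] ℝ) → ℝ} (hφ : ContDiffAt ℝ ∞ φ (locLegendre f z))
    (h : ∀ᶠ z' in 𝓝 z, φ (locLegendre f z') = 0) (w : E) :
    hessSnd f z w (dCo φ (locLegendre f z)) = 0 := by
  rw [apply_dCo]
  exact fderiv_constraint_locLegendre hf hφ h (0, w)

/-- In the fibre derivative of the energy along `w`, the two terms `DL(w)` cancel and `D²L(w, v)`
remains; the chain rule for `H` after the Legendre map gives `D²L(w, γ_H)`. -/
theorem hessSnd_apply_hamiltonian [FiniteDimensional ℝ E] {f : E × E → ℝ} {z : E × E}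
    (hf : ContDiffAt ℝ ∞ f z)
    {H : E × (E →L[ℝ] ℝ) → ℝ} (hH : ContDiffAt ℝ ∞ H (locLegendre f z))
    (h : ∀ᶠ z' in 𝓝 z, dSnd f z' z'.2 - f z' = H (locLegendre f z')) (w : E) :
    hessSnd f z w (z.2 - dCo H (locLegendre f z)) = 0 := by
  have h1 := (hH.differentiableAt_top.hasFDerivAt.comp z (hasFDerivAt_locLegendre hf)).fderiv
  have h2 := ((hf.dSnd.differentiableAt_top.hasFDerivAt.clm_apply
    (hasFDerivAt_snd (𝕜 := ℝ) (E := E) (F := E) (p := z))).sub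
    hf.differentiableAt_top.hasFDerivAt).fderiv
  have h3 := Filter.EventuallyEq.fderiv_eq (𝕜 := ℝ) h
  have h4 := DFunLike.congr_fun (h2.symm.trans (h3.trans h1)) (0, w)
  rw [map_sub, apply_dCo]
  simp [dSnd_apply] at h4
  rw [sub_eq_zero]
  exact h4

/-- The derivative of the resolution of the identity along the fibres, transposed. -/
theorem sub_hessSnd_resolution [FiniteDimensional ℝ E] {ι : Type*} [Fintype ι]
    {f : E × E → ℝ} {z : E × E} (hf : ContDiffAt ℝ ∞ f z)
    {H : E × (E →L[ℝ] ℝ) → ℝ} (hH : ContDiffAt ℝ ∞ H (locLegendre f z))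
    {φ : ι → E × (E →L[ℝ] ℝ) → ℝ} (hφ : ∀ μ, ContDiffAt ℝ ∞ (φ μ) (locLegendre f z))
    {lam : ι → E × E → ℝ} (hlam : ∀ μ, ContDiffAt ℝ ∞ (lam μ) z)
    (h : ∀ᶠ z' in 𝓝 z, z'.2 = dCo H (locLegendre f z') +
      ∑ μ, lam μ z' • dCo (φ μ) (locLegendre f z')) (α : E →L[ℝ] ℝ) :
    α - hessSnd f z ((hessCo H (locLegendre f z) +
        ∑ μ, lam μ z • hessCo (φ μ) (locLegendre f z)) α) =
      ∑ μ, α (dCo (φ μ) (locLegendre f z)) • dSnd (lam μ) z := by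
  have hd : ∀ {k : E × (E →L[ℝ] ℝ) → ℝ}, ContDiffAt ℝ ∞ k (locLegendre f z) →
      HasFDerivAt (fun z' => dCo k (locLegendre f z')) _ z := fun hk =>
    (contDiffAt_dCo hk).differentiableAt_top.hasFDerivAt.comp z (hasFDerivAt_locLegendre hf)
  have h1 := ((hd hH).add (HasFDerivAt.fun_sum (u := Finset.univ) fun μ _ =>
    (hlam μ).differentiableAt_top.hasFDerivAt.smul (hd (hφ μ)))).fderiv
  have h2 := Filter.EventuallyEq.fderiv_eq (𝕜 := ℝ) h
  have h3 : fderiv ℝ (fun z' : E × E => z'.2) z = _ := h2.trans h1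
  ext w
  have h4 := congrArg α (DFunLike.congr_fun h3 (0, w))
  -- The transposition: symmetry of the hessian of `f` moves it onto `w`, then symmetry of the
  -- hessian of `k` exchanges it with `α`.
  have h5 : ∀ {k : E × (E →L[ℝ] ℝ) → ℝ}, ContDiffAt ℝ ∞ k (locLegendre f z) →
      hessSnd f z (hessCo k (locLegendre f z) α) w = α (hessCo k (locLegendre f z) (hessSnd f z w)) :=
    fun hk => by rw [hessSnd_symm hf, hessCo_symm hk]
  simp only [fderiv_snd, _root_.add_apply, _root_.sum_apply, map_add,
    map_sum, _root_.sub_apply, _root_.smul_apply, map_smul,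
    h5 hH, h5 (hφ _)] at h4 ⊢
  have h6 : ∀ k : E × (E →L[ℝ] ℝ) → ℝ, (fderiv ℝ (dCo k) (locLegendre f z) ∘SL
      (ContinuousLinearMap.fst ℝ E E).prod (fderiv ℝ (dSnd f) z)) (0, w) =
      hessCo k (locLegendre f z) (hessSnd f z w) := fun _ => rfl
  simp only [h6, ContinuousLinearMap.coe_snd', ContinuousLinearMap.smulRight_apply, map_smul,
    Finset.sum_add_distrib, ← dSnd_apply, smul_eq_mul] at h4 ⊢
  rw [h4, ← add_assoc, add_sub_cancel_left]
  exact Finset.sum_congr rfl fun _ _ => mul_comm _ _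

/-- The form is affine in the vector, and its linear part on vertical vectors is minus the fibre
hessian. -/
theorem elForm_add_vertical (f : E × E → ℝ) (z X : E × E) (u : E) :
    elForm f z (X + (0, u)) = elForm f z X - hessSnd f z u := by
  rw [elForm, elForm, map_add, sub_sub]
  rfl

/-! ### Fibre derivatives on `T*Q` in coordinates -/

/-- The fibre derivative of a function on `T*Q`, with values in the model space. -/
def modelCoDeriv [FiniteDimensional ℝ E] (h : CoTQ E Q → ℝ) (q : Q) (β : E →L[ℝ] ℝ) : E :=
  coFibreDeriv h (coIncl q β)

/-- The fibre hessian of a function on `T*Q`, as a map of model spaces. -/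
def modelCoHessian [FiniteDimensional ℝ E] (h : CoTQ E Q → ℝ) (q : Q) (β : E →L[ℝ] ℝ) :
    (E →L[ℝ] ℝ) →L[ℝ] E :=
  coFibreHessian h (coIncl q β)

/-- The fibre derivative of a function on `TQ`, as a linear form on the model space. -/
def modelDeriv (f : TQ E Q → ℝ) (v : TQ E Q) : E →L[ℝ] ℝ := fibreDeriv f v

/-- The map `gam`, with values in the model space. -/
def modelGam [FiniteDimensional ℝ E] (L : TQ E Q → ℝ) (h : CoTQ E Q → ℝ) (v : TQ E Q) : E :=
  gam L h v

/-- The map `M`, with values in the maps of model spaces. -/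
def modelM [FiniteDimensional ℝ E] {ι : Type*} [Fintype ι] (L : TQ E Q → ℝ)
    (H : CoTQ E Q → ℝ) (φ : ι → CoTQ E Q → ℝ) (lam : ι → TQ E Q → ℝ) (v : TQ E Q) :
    (E →L[ℝ] ℝ) →L[ℝ] E :=
  M L H φ lam v

theorem modelM_eq [FiniteDimensional ℝ E] {ι : Type*} [Fintype ι] (L : TQ E Q → ℝ)
    (H : CoTQ E Q → ℝ) (φ : ι → CoTQ E Q → ℝ) (lam : ι → TQ E Q → ℝ) (v : TQ E Q) :
    modelM L H φ lam v = modelCoHessian H v.proj (modelDeriv L v) +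
      ∑ μ, lam μ v • modelCoHessian (φ μ) v.proj (modelDeriv L v) :=
  rfl

theorem hasFDerivAt_coFrame (q₀ q : Q) (x : E) (β : E →L[ℝ] ℝ) :
    HasFDerivAt (fun β : E →L[ℝ] ℝ => (x, β.comp (ofFrame q₀ q)))
      ((0 : (E →L[ℝ] ℝ) →L[ℝ] E).prod (ContinuousLinearMap.precomp ℝ (ofFrame q₀ q))) β :=
  (hasFDerivAt_const _ _).prodMk (ContinuousLinearMap.precomp ℝ (ofFrame q₀ q)).hasFDerivAt

/-- Tested against covectors, this is the chain rule in the fibre: covectors transform by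
precomposition with `ofFrame`, so fibre derivatives on `T*Q` transform by its inverse, as vectors
do. -/
theorem toFrame_modelCoDeriv [FiniteDimensional ℝ E] {h : CoTQ E Q → ℝ} {q₀ q : Q}
    (hq : q ∈ (chartAt E q₀).source) {β : E →L[ℝ] ℝ}
    (hh : DifferentiableAt ℝ (coLoc h q₀) (chartAt E q₀ q, β.comp (ofFrame q₀ q))) :
    toFrame q₀ q (modelCoDeriv h q β) =
      dCo (coLoc h q₀) (chartAt E q₀ q, β.comp (ofFrame q₀ q)) := by
  have h1 : (fun β : E →L[ℝ] ℝ => h ⟨q, β⟩) =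
      fun β => coLoc h q₀ (chartAt E q₀ q, β.comp (ofFrame q₀ q)) :=
    funext fun β => (coLoc_apply h hq β).symm
  have h2 := (HasFDerivAt.comp (g := coLoc h q₀) β hh.hasFDerivAt
    (hasFDerivAt_coFrame q₀ q (chartAt E q₀ q) β)).fderiv
  refine eq_of_forall_dual fun α => ?_
  rw [apply_dCo]
  change α (toFrame q₀ q ((bidualEquiv (E := E)).symm
    (fderiv ℝ (fun β : E →L[ℝ] ℝ => h ⟨q, β⟩) β))) = _
  rw [h1]
  refine (apply_bidualEquiv_symm _ (α.comp (toFrame q₀ q))).trans ?_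
  refine (DFunLike.congr_fun h2 _).trans ?_
  have h3 : (α.comp (toFrame q₀ q)).comp (ofFrame q₀ q) = α := by
    ext u
    exact congrArg α (toFrame_ofFrame hq u)
  exact congrArg (fun β' => fderiv ℝ (coLoc h q₀) (chartAt E q₀ q, β.comp (ofFrame q₀ q)) (0, β')) h3

theorem toFrame_modelCoHessian [FiniteDimensional ℝ E] {h : CoTQ E Q → ℝ} {q₀ q : Q}
    (hq : q ∈ (chartAt E q₀).source) {β : E →L[ℝ] ℝ}
    (hh : ContDiffAt ℝ ∞ (coLoc h q₀) (chartAt E q₀ q, β.comp (ofFrame q₀ q)))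
    (α : E →L[ℝ] ℝ) :
    toFrame q₀ q (modelCoHessian h q β α) =
      hessCo (coLoc h q₀) (chartAt E q₀ q, β.comp (ofFrame q₀ q)) (α.comp (ofFrame q₀ q)) := by
  have hd := hasFDerivAt_coFrame q₀ q (chartAt E q₀ q) β
  have h1 : modelCoDeriv h q =ᶠ[𝓝 β]
      fun β => ofFrame q₀ q (dCo (coLoc h q₀) (chartAt E q₀ q, β.comp (ofFrame q₀ q))) := by
    filter_upwards [hd.continuousAt.eventually hh.eventually_top] with β' hβ'
    rw [← toFrame_modelCoDeriv hq hβ', ofFrame_toFrame hq]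
  have h2 := (ofFrame q₀ q).hasFDerivAt.comp β
    (HasFDerivAt.comp (g := dCo (coLoc h q₀)) β
      (contDiffAt_dCo hh).differentiableAt_top.hasFDerivAt hd)
  change toFrame q₀ q (fderiv ℝ (modelCoDeriv h q) β α) = _
  rw [h1.fderiv_eq]
  refine (congrArg (toFrame q₀ q) (DFunLike.congr_fun h2.fderiv α)).trans ?_
  exact toFrame_ofFrame hq _

variable {L : TQ E Q → ℝ} {O : Set (CoTQ E Q)}

theorem legendre_coords (hL : ContMDiff (modelTQ E) 𝓘(ℝ, ℝ) ∞ L)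
    {q₀ : Q} {v : TQ E Q} (hq : v.proj ∈ (chartAt E q₀).source) :
    (chartAt E q₀ v.proj, (modelDeriv L v).comp (ofFrame q₀ v.proj)) =
      locLegendre (loc L q₀) (tqChart q₀ v) := by
  rw [← coChart_legendre hL hq]
  exact (coChart_apply (p := legendre L v) hq).symm

theorem contDiffAt_coLoc_legendre (hL : ContMDiff (modelTQ E) 𝓘(ℝ, ℝ) ∞ L) (hO : IsOpen O)
    {h : CoTQ E Q → ℝ} (hh : ContMDiffOn (modelCoTQ E) 𝓘(ℝ, ℝ) ∞ h O)
    {q₀ : Q} {v : TQ E Q} (hq : v.proj ∈ (chartAt E q₀).source) (hv : legendre L v ∈ O) :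
    ContDiffAt ℝ ∞ (coLoc h q₀) (locLegendre (loc L q₀) (tqChart q₀ v)) := by
  have hs : legendre L v ∈ (coChart q₀).source := mem_coChart_source.2 hq
  rw [← coChart_legendre hL hq]
  refine contDiffAt_coLoc hO hh ((coChart q₀).map_source hs) ?_
  rwa [(coChart q₀).left_inv hs]

theorem toFrame_modelGam [FiniteDimensional ℝ E] (hL : ContMDiff (modelTQ E) 𝓘(ℝ, ℝ) ∞ L)
    (hO : IsOpen O)
    {h : CoTQ E Q → ℝ} (hh : ContMDiffOn (modelCoTQ E) 𝓘(ℝ, ℝ) ∞ h O)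
    {q₀ : Q} {v : TQ E Q} (hq : v.proj ∈ (chartAt E q₀).source) (hv : legendre L v ∈ O) :
    toFrame q₀ v.proj (modelGam L h v) =
      dCo (coLoc h q₀) (locLegendre (loc L q₀) (tqChart q₀ v)) := by
  have h1 := (contDiffAt_coLoc_legendre hL hO hh hq hv).differentiableAt_top
  rw [← legendre_coords hL hq] at h1 ⊢
  exact toFrame_modelCoDeriv hq h1

theorem toFrame_modelCoHessian_legendre [FiniteDimensional ℝ E]
    (hL : ContMDiff (modelTQ E) 𝓘(ℝ, ℝ) ∞ L) (hO : IsOpen O)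
    {h : CoTQ E Q → ℝ} (hh : ContMDiffOn (modelCoTQ E) 𝓘(ℝ, ℝ) ∞ h O)
    {q₀ : Q} {v : TQ E Q} (hq : v.proj ∈ (chartAt E q₀).source) (hv : legendre L v ∈ O)
    (α : E →L[ℝ] ℝ) :
    toFrame q₀ v.proj (modelCoHessian h v.proj (modelDeriv L v) α) =
      hessCo (coLoc h q₀) (locLegendre (loc L q₀) (tqChart q₀ v)) (α.comp (ofFrame q₀ v.proj)) := by
  have h1 := contDiffAt_coLoc_legendre hL hO hh hq hv
  rw [← legendre_coords hL hq] at h1 ⊢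
  exact toFrame_modelCoHessian hq h1 α

theorem toFrame_modelM [FiniteDimensional ℝ E] {ι : Type*} [Fintype ι]
    (hL : ContMDiff (modelTQ E) 𝓘(ℝ, ℝ) ∞ L) (hO : IsOpen O)
    {H : CoTQ E Q → ℝ} (hH : ContMDiffOn (modelCoTQ E) 𝓘(ℝ, ℝ) ∞ H O)
    {φ : ι → CoTQ E Q → ℝ} (hφ : ∀ μ, ContMDiffOn (modelCoTQ E) 𝓘(ℝ, ℝ) ∞ (φ μ) O)
    (lam : ι → TQ E Q → ℝ)
    {q₀ : Q} {v : TQ E Q} (hq : v.proj ∈ (chartAt E q₀).source) (hv : legendre L v ∈ O)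
    (α : E →L[ℝ] ℝ) :
    toFrame q₀ v.proj (modelM L H φ lam v α) =
      (hessCo (coLoc H q₀) (locLegendre (loc L q₀) (tqChart q₀ v)) +
        ∑ μ, lam μ v • hessCo (coLoc (φ μ) q₀) (locLegendre (loc L q₀) (tqChart q₀ v)))
        (α.comp (ofFrame q₀ v.proj)) := by
  rw [modelM_eq, add_apply, sum_apply, map_add, map_sum,
    toFrame_modelCoHessian_legendre hL hO hH hq hv, add_apply, sum_apply]
  refine congrArg _ (Finset.sum_congr rfl fun μ _ => ?_)
  rw [smul_apply, map_smul, toFrame_modelCoHessian_legendre hL hO (hφ μ) hq hv]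
  rfl

/-! ### Hamiltonians, constraints and resolutions in coordinates -/

theorem eventually_tqChart_symm_mem {U : Set (TQ E Q)} (hU : IsOpen U) {q₀ : Q} {v : TQ E Q}
    (hq : v.proj ∈ (chartAt E q₀).source) (hv : v ∈ U) :
    ∀ᶠ z in 𝓝 (tqChart q₀ v), z ∈ (tqChart q₀).target ∧ (tqChart q₀).symm z ∈ U := by
  have hs := mem_tqChart_source.2 hq
  have hz := (isOpen_tqChart_target q₀).mem_nhds ((tqChart q₀).map_source hs)
  refine Filter.Eventually.and hz ?_
  refine ((contMDiffOn_tqChart_symm q₀).continuousOn.continuousAt hz).eventually (hU.mem_nhds ?_)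
  rwa [(tqChart q₀).left_inv hs]

theorem isOpen_legendre_preimage (hL : ContMDiff (modelTQ E) 𝓘(ℝ, ℝ) ∞ L) (hO : IsOpen O) :
    IsOpen (legendre L ⁻¹' O) :=
  hO.preimage (contMDiff_legendre hL).continuous

theorem modelDeriv_eq_dSnd {f : TQ E Q → ℝ} {q₀ : Q} {v : TQ E Q}
    (hq : v.proj ∈ (chartAt E q₀).source) (hf : DifferentiableAt ℝ (loc f q₀) (tqChart q₀ v)) :
    modelDeriv f v = (dSnd (loc f q₀) (tqChart q₀ v)).comp (toFrame q₀ v.proj) :=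
  fibreDeriv_eq_dSnd hq hf

theorem eventually_hamiltonian (hL : ContMDiff (modelTQ E) 𝓘(ℝ, ℝ) ∞ L) (hO : IsOpen O)
    {H : CoTQ E Q → ℝ} (hH : IsHamiltonian L O H) {q₀ : Q} {v : TQ E Q}
    (hq : v.proj ∈ (chartAt E q₀).source) (hv : legendre L v ∈ O) :
    ∀ᶠ z in 𝓝 (tqChart q₀ v), dSnd (loc L q₀) z z.2 - loc L q₀ z =
      coLoc H q₀ (locLegendre (loc L q₀) z) := by
  filter_upwards [eventually_tqChart_symm_mem (isOpen_legendre_preimage hL hO) hq hv] with z hz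
  rw [coLoc, ← legendre_tqChart_symm hL hz.1, ← hH.energy_eq _ hz.2]
  have hq' := mem_tqChart_source.1 ((tqChart q₀).map_target hz.1)
  have h1 := modelDeriv_eq_dSnd (f := L) hq' (by
    rw [(tqChart q₀).right_inv hz.1]
    exact (contDiffAt_loc_of_contMDiff hL hz.1).differentiableAt_top)
  have h2 : modelDeriv L ((tqChart q₀).symm z) (vec ((tqChart q₀).symm z)) =
      dSnd (loc L q₀) z z.2 := by
    have h3 : toFrame q₀ ((tqChart q₀).symm z).proj (vec ((tqChart q₀).symm z)) = z.2 :=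
      congrArg Prod.snd ((tqChart q₀).right_inv hz.1)
    rw [h1, ContinuousLinearMap.comp_apply, h3, (tqChart q₀).right_inv hz.1]
  rw [← h2]
  rfl

theorem eventually_constraint {ι : Type*} (hL : ContMDiff (modelTQ E) 𝓘(ℝ, ℝ) ∞ L)
    (hO : IsOpen O) {φ : ι → CoTQ E Q → ℝ} (hφ : IsIndependentPrimaryConstraints L O φ)
    {q₀ : Q} {v : TQ E Q} (hq : v.proj ∈ (chartAt E q₀).source) (hv : legendre L v ∈ O) (μ : ι) :
    ∀ᶠ z in 𝓝 (tqChart q₀ v), coLoc (φ μ) q₀ (locLegendre (loc L q₀) z) = 0 := by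
  filter_upwards [eventually_tqChart_symm_mem (isOpen_legendre_preimage hL hO) hq hv] with z hz
  rw [coLoc, ← legendre_tqChart_symm hL hz.1]
  have h : legendre L ((tqChart q₀).symm z) ∈ range (legendre L) ∩ O := ⟨mem_range_self _, hz.2⟩
  rw [hφ.defines] at h
  exact h.2 μ

theorem resolution_coords [FiniteDimensional ℝ E] {ι : Type*} [Fintype ι]
    (hL : ContMDiff (modelTQ E) 𝓘(ℝ, ℝ) ∞ L) (hO : IsOpen O)
    {H : CoTQ E Q → ℝ} (hH : ContMDiffOn (modelCoTQ E) 𝓘(ℝ, ℝ) ∞ H O)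
    {φ : ι → CoTQ E Q → ℝ} (hφ : ∀ μ, ContMDiffOn (modelCoTQ E) 𝓘(ℝ, ℝ) ∞ (φ μ) O)
    (c : ι → ℝ) {q₀ : Q} {v : TQ E Q}
    (hq : v.proj ∈ (chartAt E q₀).source) (hv : legendre L v ∈ O)
    (h : vec v = modelGam L H v + ∑ μ, c μ • modelGam L (φ μ) v) :
    (tqChart q₀ v).2 = dCo (coLoc H q₀) (locLegendre (loc L q₀) (tqChart q₀ v)) +
      ∑ μ, c μ • dCo (coLoc (φ μ) q₀) (locLegendre (loc L q₀) (tqChart q₀ v)) := by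
  have h1 := congrArg (toFrame q₀ v.proj) h
  simp only [map_add, map_sum, map_smul, toFrame_modelGam hL hO hH hq hv,
    toFrame_modelGam hL hO (hφ _) hq hv] at h1
  exact h1

theorem eventually_resolution [FiniteDimensional ℝ E] {ι : Type*} [Fintype ι]
    (hL : ContMDiff (modelTQ E) 𝓘(ℝ, ℝ) ∞ L) (hO : IsOpen O)
    {H : CoTQ E Q → ℝ} (hH : ContMDiffOn (modelCoTQ E) 𝓘(ℝ, ℝ) ∞ H O)
    {φ : ι → CoTQ E Q → ℝ} (hφ : ∀ μ, ContMDiffOn (modelCoTQ E) 𝓘(ℝ, ℝ) ∞ (φ μ) O)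
    {U : Set (TQ E Q)} (hU : IsOpen U) (hUO : U ⊆ legendre L ⁻¹' O) {lam : ι → TQ E Q → ℝ}
    (hlam : ∀ v ∈ U, vec v = modelGam L H v + ∑ μ, lam μ v • modelGam L (φ μ) v)
    {q₀ : Q} {v : TQ E Q} (hq : v.proj ∈ (chartAt E q₀).source) (hv : v ∈ U) :
    ∀ᶠ z in 𝓝 (tqChart q₀ v), z.2 = dCo (coLoc H q₀) (locLegendre (loc L q₀) z) +
      ∑ μ, loc (lam μ) q₀ z • dCo (coLoc (φ μ) q₀) (locLegendre (loc L q₀) z) := by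
  filter_upwards [eventually_tqChart_symm_mem hU hq hv] with z hz
  have hq' := mem_tqChart_source.1 ((tqChart q₀).map_target hz.1)
  have h := resolution_coords hL hO hH hφ _ hq' (hUO hz.2) (hlam _ hz.2)
  rwa [(tqChart q₀).right_inv hz.1] at h

/-! ### The kernel of the fibre hessian -/

theorem coeff_eq_zero_of_forms {F : Type*} [NormedAddCommGroup F] [NormedSpace ℝ F] {ι : Type*}
    [Fintype ι] {ξ : ι → F →L[ℝ] ℝ} (hi : LinearIndependent ℝ ξ) (c : ι → ℝ)
    (hc : ∀ Y, ∑ μ, c μ * ξ μ Y = 0) : ∀ μ, c μ = 0 :=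
  Fintype.linearIndependent_iff.1 hi c (ContinuousLinearMap.ext fun Y => by simpa using hc Y)

/-- A relation among the `γ_μ` is a relation among the differentials of the `φ μ` on vertical
vectors. The tangent map of `locLegendre f` projects onto the whole base, so every vector is
vertical modulo its image, which these differentials kill; the relation thus holds everywhere. -/
theorem linearIndependent_dCo [FiniteDimensional ℝ E] {ι : Type*} [Fintype ι] {f : E × E → ℝ}
    {z : E × E} (hf : ContDiffAt ℝ ∞ f z) {φ : ι → E × (E →L[ℝ] ℝ) → ℝ}
    (hφ : ∀ μ, ContDiffAt ℝ ∞ (φ μ) (locLegendre f z))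
    (h : ∀ μ, ∀ᶠ z' in 𝓝 z, φ μ (locLegendre f z') = 0)
    (hi : LinearIndependent ℝ fun μ => fderiv ℝ (φ μ) (locLegendre f z)) :
    LinearIndependent ℝ fun μ => dCo (φ μ) (locLegendre f z) := by
  refine Fintype.linearIndependent_iff.2 fun c hc => ?_
  refine coeff_eq_zero_of_forms hi c fun Y => ?_
  have h1 : ∀ β : E →L[ℝ] ℝ, ∑ μ, c μ * fderiv ℝ (φ μ) (locLegendre f z) (0, β) = 0 := by
    intro β
    have := congrArg β hc
    simpa [map_sum, apply_dCo] using this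
  -- Subtract from `Y` the image of `(Y.1, 0)` under the tangent Legendre map: the difference is
  -- vertical, and the subtracted vector is killed.
  have h2 : ∀ μ, fderiv ℝ (φ μ) (locLegendre f z) Y =
      fderiv ℝ (φ μ) (locLegendre f z) (0, Y.2 - fderiv ℝ (dSnd f) z (Y.1, 0)) := by
    intro μ
    have h3 := fderiv_constraint_locLegendre hf (hφ μ) (h μ) (Y.1, 0)
    rw [← add_zero (fderiv ℝ (φ μ) (locLegendre f z) (0, _)), ← h3, ← map_add]
    simp
  simp only [h2]
  exact h1 _

/-- Otherwise a linear form kills all `γ μ` but not `u`. Such a form lies in the image of the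
hessian, and those forms kill `u`. -/
theorem mem_span_dCo [FiniteDimensional ℝ E] {ι : Type*} {f : E × E → ℝ} {z : E × E} {γ : ι → E}
    (h : ∀ β : E →L[ℝ] ℝ, (∀ μ, β (γ μ) = 0) → ∃ w, hessSnd f z w = β) {u : E}
    (hu : ∀ w, hessSnd f z w u = 0) : u ∈ Submodule.span ℝ (range γ) := by
  by_contra hn
  obtain ⟨ξ, hξ, hker⟩ := Submodule.exists_le_ker_of_notMem hn
  obtain ⟨w, hw⟩ := h (LinearMap.toContinuousLinearMap ξ)
    (fun μ => hker (Submodule.subset_span (mem_range_self μ)))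
  refine hξ ?_
  have := hu w
  rwa [hw] at this

/-- If a function vanishes on the common zero set of independent functions, its differential kills
the vectors killed by their differentials. -/
theorem fderiv_eq_zero_of_vanishing {F : Type*} [NormedAddCommGroup F] [NormedSpace ℝ F]
    [CompleteSpace F] {ι : Type*} [Fintype ι] {φ : ι → F → ℝ} {g : F → ℝ} {y : F}
    (hφ : ∀ μ, ContDiffAt ℝ ∞ (φ μ) y) (hg : ContDiffAt ℝ ∞ g y) (hy : ∀ μ, φ μ y = 0)
    (hi : LinearIndependent ℝ fun μ => fderiv ℝ (φ μ) y)
    (hvan : ∀ᶠ x in 𝓝 y, (∀ μ, φ μ x = 0) → g x = 0) {Y : F} (hY : ∀ μ, fderiv ℝ (φ μ) y Y = 0) :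
    fderiv ℝ g y Y = 0 := by
  -- A function that is constant on the constraint set has a constrained local extremum at `y`, so
  -- Lagrange multipliers express its differential through those of the constraints.
  have hext : IsLocalExtrOn g {x | ∀ μ, φ μ x = φ μ y} y := by
    refine Or.inl ?_
    have hgy : g y = 0 := hvan.self_of_nhds hy
    refine Filter.eventually_inf_principal.2 (hvan.mono fun x hx hxS => ?_)
    rw [hgy, hx fun μ => (hxS μ).trans (hy μ)]
  obtain ⟨Λ, Λ₀, hne, hsum⟩ := hext.exists_multipliers_of_hasStrictFDerivAt
    (fun μ => (hφ μ).hasStrictFDerivAt (by simp)) (hg.hasStrictFDerivAt (by simp))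
  -- A zero multiplier on `g` would leave a nontrivial relation among the independent differentials.
  have h0 : Λ₀ ≠ 0 := by
    rintro rfl
    refine hne (Prod.ext (funext ?_) rfl)
    rw [zero_smul, add_zero] at hsum
    exact Fintype.linearIndependent_iff.1 hi Λ hsum
  have := DFunLike.congr_fun hsum Y
  simpa [hY, h0] using this

theorem linearIndependent_fderiv_coLoc {ι : Type*} (hL : ContMDiff (modelTQ E) 𝓘(ℝ, ℝ) ∞ L)
    (hO : IsOpen O) {φ : ι → CoTQ E Q → ℝ} (hφ : IsIndependentPrimaryConstraints L O φ)
    {v : TQ E Q} (hv : legendre L v ∈ O) :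
    LinearIndependent ℝ fun μ => fderiv ℝ (coLoc (φ μ) v.proj)
      (locLegendre (loc L v.proj) (tqChart v.proj v)) := by
  rw [← coChart_legendre hL (mem_chart_source E v.proj)]
  have h := hφ.independent _ ⟨mem_range_self v, hv⟩
  have h1 : (fun μ => differential (modelCoTQ E) (φ μ) (legendre L v)) = fun μ =>
      fderiv ℝ (coLoc (φ μ) v.proj) (coChart v.proj (legendre L v)) :=
    funext fun μ => differential_eq_fderiv hO (hφ.smooth μ) hv
  rw [h1] at h
  exact h

/-- The condition on `β` says that the vertical vector `(0, β)` is killed by the differentials of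
all constraints, hence is tangent to the image of the Legendre map. The submersion hypothesis lifts
it to `TQ`; the Legendre map preserves base points, so the lift is vertical, and on vertical vectors
the tangent map is the hessian. -/
theorem exists_hessSnd_eq [FiniteDimensional ℝ E] {ι : Type*} [Fintype ι]
    (hL : ContMDiff (modelTQ E) 𝓘(ℝ, ℝ) ∞ L) (hreg : AlmostRegular L)
    (hO : IsOpen O) {φ : ι → CoTQ E Q → ℝ} (hφ : IsIndependentPrimaryConstraints L O φ)
    {v : TQ E Q} (hv : legendre L v ∈ O) (β : E →L[ℝ] ℝ)
    (hβ : ∀ μ, β (dCo (coLoc (φ μ) v.proj)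
      (locLegendre (loc L v.proj) (tqChart v.proj v))) = 0) :
    ∃ w, hessSnd (loc L v.proj) (tqChart v.proj v) w = β := by
  have hq := mem_chart_source E v.proj
  have hs : legendre L v ∈ (coChart v.proj).source := mem_coChart_source.2 hq
  have ht := (coChart v.proj).map_source hs
  have hz : tqChart v.proj v ∈ (tqChart v.proj).target :=
    (tqChart v.proj).map_source (mem_tqChart_source.2 hq)
  have hf := contDiffAt_loc_of_contMDiff hL hz
  have hcont : ContinuousAt (coChart v.proj).symm (coChart v.proj (legendre L v)) :=
    (contMDiffOn_coChart_symm v.proj).continuousOn.continuousAt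
      ((isOpen_coChart_target v.proj).mem_nhds ht)
  have hmem : ((0, β) : E × (E →L[ℝ] ℝ)) ∈
      tangentSubspace (modelCoTQ E) (range (legendre L)) (legendre L v) := by
    intro O' g hO' hp hg hvan
    rw [differential_eq_fderiv hO' hg hp]
    change fderiv ℝ (coLoc g v.proj) (coChart v.proj (legendre L v)) (0, β) = 0
    -- `tangentSubspace` tests against every function `g` vanishing on the image. Near the point the
    -- image is the common zero set of the constraints, so testing against the constraints suffices.
    refine fderiv_eq_zero_of_vanishing (φ := fun μ => coLoc (φ μ) v.proj)
      (y := coChart v.proj (legendre L v)) (fun μ => ?_) ?_ (fun μ => ?_) ?_ ?_ (fun μ => ?_)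
    · exact contDiffAt_coLoc hO (hφ.smooth μ) ht (by rwa [(coChart v.proj).left_inv hs])
    · exact contDiffAt_coLoc hO' hg ht (by rwa [(coChart v.proj).left_inv hs])
    · have h : legendre L v ∈ range (legendre L) ∩ O := ⟨mem_range_self _, hv⟩
      rw [hφ.defines] at h
      rw [coLoc, (coChart v.proj).left_inv hs]
      exact h.2 μ
    · rw [coChart_legendre hL hq]
      exact linearIndependent_fderiv_coLoc hL hO hφ hv
    · have hn : ∀ᶠ y in 𝓝 (coChart v.proj (legendre L v)), (coChart v.proj).symm y ∈ O ∩ O' := by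
        refine hcont.eventually ((hO.inter hO').mem_nhds ?_)
        rw [(coChart v.proj).left_inv hs]
        exact ⟨hv, hp⟩
      filter_upwards [hn] with y hy h0
      have h1 : (coChart v.proj).symm y ∈ range (legendre L) ∩ O := by
        rw [hφ.defines]
        exact ⟨hy.1, h0⟩
      exact hvan _ ⟨h1.1, hy.2⟩
    · rw [coChart_legendre hL hq, ← apply_dCo]
      exact hβ μ
  rw [← hreg.submersion v] at hmem
  obtain ⟨X, hX⟩ := hmem
  have hX' : fderiv ℝ (locLegendre (loc L v.proj)) (tqChart v.proj v) (X : E × E) = (0, β) := by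
    rw [← hX, mfderiv_legendre hL]
    rfl
  rw [(hasFDerivAt_locLegendre hf).fderiv] at hX'
  have h1 : (X : E × E).1 = 0 := congrArg Prod.fst hX'
  have h2 : fderiv ℝ (dSnd (loc L v.proj)) (tqChart v.proj v) (X : E × E) = β :=
    congrArg Prod.snd hX'
  refine ⟨(X : E × E).2, ?_⟩
  rw [← h2]
  have h3 : ((0, (X : E × E).2) : E × E) = X := Prod.ext h1.symm rfl
  exact congrArg (fderiv ℝ (dSnd (loc L v.proj)) (tqChart v.proj v)) h3

theorem modelGam_eq_dCo [FiniteDimensional ℝ E] (hL : ContMDiff (modelTQ E) 𝓘(ℝ, ℝ) ∞ L)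
    (hO : IsOpen O) {h : CoTQ E Q → ℝ} (hh : ContMDiffOn (modelCoTQ E) 𝓘(ℝ, ℝ) ∞ h O)
    {v : TQ E Q} (hv : legendre L v ∈ O) :
    modelGam L h v = dCo (coLoc h v.proj) (locLegendre (loc L v.proj) (tqChart v.proj v)) := by
  rw [← toFrame_modelGam hL hO hh (mem_chart_source E v.proj) hv, toFrame_self]
  rfl

theorem tqChart_self_snd (v : TQ E Q) : (tqChart v.proj v).2 = vec v := by
  rw [tqChart_apply, toFrame_self]
  rfl

theorem exists_resolution_at [FiniteDimensional ℝ E] {ι : Type*} [Fintype ι]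
    (hL : ContMDiff (modelTQ E) 𝓘(ℝ, ℝ) ∞ L) (hreg : AlmostRegular L)
    (hO : IsOpen O) {φ : ι → CoTQ E Q → ℝ} (hφ : IsIndependentPrimaryConstraints L O φ)
    {H : CoTQ E Q → ℝ} (hH : IsHamiltonian L O H) {v : TQ E Q} (hv : legendre L v ∈ O) :
    ∃ c : ι → ℝ, vec v = modelGam L H v + ∑ μ, c μ • modelGam L (φ μ) v := by
  have hq := mem_chart_source E v.proj
  have hz : tqChart v.proj v ∈ (tqChart v.proj).target :=
    (tqChart v.proj).map_source (mem_tqChart_source.2 hq)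
  have hf := contDiffAt_loc_of_contMDiff hL hz
  have h1 := mem_span_dCo (exists_hessSnd_eq hL hreg hO hφ hv)
    (hessSnd_apply_hamiltonian hf (contDiffAt_coLoc_legendre hL hO hH.smooth hq hv)
      (eventually_hamiltonian hL hO hH hq hv))
  obtain ⟨c, hc⟩ := (Submodule.mem_span_range_iff_exists_fun ℝ).1 h1
  refine ⟨c, ?_⟩
  simp only [modelGam_eq_dCo hL hO hH.smooth hv, modelGam_eq_dCo hL hO (hφ.smooth _) hv]
  rw [hc, tqChart_self_snd, add_sub_cancel]

/-- The coefficients of a smooth vector with respect to independent smooth vectors are smooth. -/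
theorem contDiffAt_coefficients {F G : Type*} [NormedAddCommGroup F] [NormedSpace ℝ F]
    [NormedAddCommGroup G] [NormedSpace ℝ G] [FiniteDimensional ℝ G] {ι : Type*} [Fintype ι]
    {γ : ι → F → G} {b : F → G} {c : ι → F → ℝ} {x : F} (hγ : ∀ μ, ContDiffAt ℝ ∞ (γ μ) x)
    (hb : ContDiffAt ℝ ∞ b x) (hi : LinearIndependent ℝ fun μ => γ μ x)
    (h : ∀ᶠ y in 𝓝 x, b y = ∑ μ, c μ y • γ μ y) (μ : ι) : ContDiffAt ℝ ∞ (c μ) x := by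
  classical
  -- `P₀` recovers the coefficients at `x`. Applied to the moving vectors it gives the matrix `A y`,
  -- smooth in `y` and equal to the identity at `x`, hence invertible nearby; there `c = A⁻¹ P b`.
  -- No regularity of `c` is needed in advance.
  obtain ⟨P₀, hP₀⟩ := (Fintype.linearCombination ℝ fun μ => γ μ x).exists_leftInverse_of_injective
    (LinearMap.ker_eq_bot.2 hi.fintypeLinearCombination_injective)
  let P : G →L[ℝ] (ι → ℝ) := LinearMap.toContinuousLinearMap P₀
  let A : F → ((ι → ℝ) →L[ℝ] (ι → ℝ)) := fun y =>
    ∑ ν, (ContinuousLinearMap.proj ν : (ι → ℝ) →L[ℝ] ℝ).smulRight (P (γ ν y))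
  have hAapp : ∀ y a, A y a = P (∑ ν, a ν • γ ν y) := fun y a => by
    simp [A, sum_apply]
  have hAx : A x = 1 := by
    ext1 a
    rw [hAapp]
    exact DFunLike.congr_fun hP₀ a
  have hA : ContDiffAt ℝ ∞ A x := by
    refine ContDiffAt.sum fun ν _ => ?_
    exact contDiffAt_const.smulRight (P.contDiff.contDiffAt.comp x (hγ ν))
  have hinv : ContDiffAt ℝ ∞ (fun y => Ring.inverse (A y)) x := by
    refine ContDiffAt.comp x (g := Ring.inverse) ?_ hA
    rw [hAx]
    exact contDiffAt_ringInverse ℝ (1 : ((ι → ℝ) →L[ℝ] (ι → ℝ))ˣ)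
  have hunit : ∀ᶠ y in 𝓝 x, IsUnit (A y) := by
    refine hA.continuousAt.eventually (Units.isOpen.mem_nhds ?_)
    rw [hAx]
    exact isUnit_one
  have hc : (fun y => (fun ν => c ν y)) =ᶠ[𝓝 x] fun y => Ring.inverse (A y) (P (b y)) := by
    filter_upwards [h, hunit] with y hy hu
    have h1 : P (b y) = A y (fun ν => c ν y) := by rw [hAapp, hy]
    rw [h1, ← mul_apply_eq_comp, Ring.inverse_mul_cancel _ hu]
    rfl
  have h2 : ContDiffAt ℝ ∞ (fun y => (fun ν => c ν y)) x :=
    (hinv.clm_apply (P.contDiff.contDiffAt.comp x hb)).congr_of_eventuallyEq hc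
  exact contDiffAt_pi.1 h2 μ

theorem contMDiffAt_of_loc {f : TQ E Q → ℝ} {v : TQ E Q}
    (hf : ContDiffAt ℝ ∞ (loc f v.proj) (tqChart v.proj v)) :
    ContMDiffAt (modelTQ E) 𝓘(ℝ, ℝ) ∞ f v := by
  have hv : v ∈ (tqChart v.proj).source := mem_tqChart_source.2 (mem_chart_source E v.proj)
  have ho : IsOpen (tqChart (E := E) v.proj).source := isOpen_extChartAt_source _
  have h1 : ContMDiffAt (modelTQ E) 𝓘(ℝ, E × E) ∞ (tqChart v.proj) v :=
    (contMDiffOn_tqChart v.proj).contMDiffAt (ho.mem_nhds hv)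
  refine (hf.contMDiffAt.comp v h1).congr_of_eventuallyEq ?_
  filter_upwards [ho.mem_nhds hv] with y hy
  exact congrArg f ((tqChart v.proj).left_inv hy).symm

/-- The coefficients are chosen point by point, with the irrelevant value `0` off the preimage of
`O`. Independence of the `γ_μ` then forces any such choice to be smooth. -/
theorem exists_isResolution [FiniteDimensional ℝ E] {ι : Type*} [Fintype ι]
    (hL : ContMDiff (modelTQ E) 𝓘(ℝ, ℝ) ∞ L) (hreg : AlmostRegular L)
    (hO : IsOpen O) {φ : ι → CoTQ E Q → ℝ} (hφ : IsIndependentPrimaryConstraints L O φ)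
    {H : CoTQ E Q → ℝ} (hH : IsHamiltonian L O H) :
    ∃ lam : ι → TQ E Q → ℝ, IsResolution L H φ (legendre L ⁻¹' O) lam := by
  classical
  have hex : ∀ v : TQ E Q, ∃ c : ι → ℝ, legendre L v ∈ O →
      vec v = modelGam L H v + ∑ μ, c μ • modelGam L (φ μ) v := fun v => by
    by_cases hv : legendre L v ∈ O
    · obtain ⟨c, hc⟩ := exists_resolution_at hL hreg hO hφ hH hv
      exact ⟨c, fun _ => hc⟩
    · exact ⟨0, fun h => absurd h hv⟩
  choose c hc using hex
  refine ⟨fun μ v => c v μ, ⟨fun μ v hv => ?_, fun v hv => hc v hv⟩⟩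
  refine (contMDiffAt_of_loc ?_).contMDiffWithinAt
  have hq := mem_chart_source E v.proj
  have hz : tqChart v.proj v ∈ (tqChart v.proj).target :=
    (tqChart v.proj).map_source (mem_tqChart_source.2 hq)
  have hf := contDiffAt_loc_of_contMDiff hL hz
  have hφc := fun μ => contDiffAt_coLoc_legendre hL hO (hφ.smooth μ) hq hv
  have hcomp : ∀ {h : CoTQ E Q → ℝ}, ContMDiffOn (modelCoTQ E) 𝓘(ℝ, ℝ) ∞ h O →
      ContDiffAt ℝ ∞ (fun z => dCo (coLoc h v.proj) (locLegendre (loc L v.proj) z))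
        (tqChart v.proj v) := fun hh =>
    (contDiffAt_dCo (contDiffAt_coLoc_legendre hL hO hh hq hv)).comp _ (contDiffAt_locLegendre hf)
  refine contDiffAt_coefficients (γ := fun μ z => dCo (coLoc (φ μ) v.proj)
      (locLegendre (loc L v.proj) z)) (c := fun μ => loc (fun v => c v μ) v.proj)
    (b := fun z => z.2 - dCo (coLoc H v.proj) (locLegendre (loc L v.proj) z))
    (fun μ => hcomp (hφ.smooth μ)) (contDiffAt_snd.sub (hcomp hH.smooth)) ?_ ?_ μ
  · exact linearIndependent_dCo hf hφc (eventually_constraint hL hO hφ hq hv)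
      (linearIndependent_fderiv_coLoc hL hO hφ hv)
  · filter_upwards [eventually_resolution hL hO hH.smooth hφ.smooth
      (isOpen_legendre_preimage hL hO) subset_rfl (lam := fun μ v => c v μ) hc hq hv] with z hz
    rw [sub_eq_iff_eq_add', ← hz]

/-! ### The Euler-Lagrange form and the vertical lift -/

/-- The Euler-Lagrange form, as a linear form on the model space. -/
def modelEL (L : TQ E Q → ℝ) (v : TQ E Q) (X : E × E) : E →L[ℝ] ℝ := eulerLagrange L v X

/-- A tangent vector of `TQ` as an element of the model space. -/
def modelVec (v : TQ E Q) (X : TangentSpace (modelTQ E) v) : E × E := X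

theorem coe_verticalLift (v : TQ E Q) (w : E) :
    modelVec v (verticalLift v w : TangentSpace (modelTQ E) v) = (0, w) :=
  fibreInclDeriv_apply v.proj (vec v) w

theorem eulerLagrangeHat_verticalLift (L : TQ E Q → ℝ) (v : TQ E Q) (X w : _) :
    eulerLagrangeHat L v X (verticalLift v w) = eulerLagrange L v X w :=
  congrArg (eulerLagrange L v X) ((verticalLift v).symm_apply_apply w)

theorem chi_eq [FiniteDimensional ℝ E] (L : TQ E Q → ℝ) (φ : CoTQ E Q → ℝ)
    (X₀ : ∀ v : TQ E Q, TangentSpace (modelTQ E) v) (v : TQ E Q) :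
    chi L φ X₀ v = modelEL L v (modelVec v (X₀ v)) (modelGam L φ v) :=
  eulerLagrangeHat_verticalLift L v (X₀ v) (gam L φ v)

theorem D₀_eq [FiniteDimensional ℝ E] {ι : Type*} [Fintype ι] (L : TQ E Q → ℝ)
    (H : CoTQ E Q → ℝ) (φ : ι → CoTQ E Q → ℝ) (lam : ι → TQ E Q → ℝ)
    (X₀ : ∀ v : TQ E Q, TangentSpace (modelTQ E) v) (v : TQ E Q) :
    modelVec v (D₀ L H φ lam X₀ v) =
      modelVec v (X₀ v) + (0, modelM L H φ lam v (modelEL L v (modelVec v (X₀ v)))) := by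
  have h1 : (LinearMap.toContinuousLinearMap
      (eulerLagrangeHat L v (X₀ v) ∘ₗ (verticalLift v).toLinearMap : E →ₗ[ℝ] ℝ)) =
      modelEL L v (modelVec v (X₀ v)) :=
    ContinuousLinearMap.ext fun w => eulerLagrangeHat_verticalLift L v (X₀ v) w
  have h2 : modelVec v (Mhat L H φ lam v (eulerLagrangeHat L v (X₀ v)) : TangentSpace (modelTQ E) v) =
      (0, modelM L H φ lam v (modelEL L v (modelVec v (X₀ v)))) := by
    rw [← h1]
    exact coe_verticalLift v _
  exact congrArg (fun Y : E × E => modelVec v (X₀ v) + Y) h2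

theorem sum_smul_verticalCovector {ι : Type*} [Fintype ι] (v : TQ E Q) (c : ι → ℝ)
    (α : ι → E →L[ℝ] ℝ) :
    ∑ μ, c μ • verticalCovector v (α μ) = verticalCovector v (∑ μ, c μ • α μ : E →L[ℝ] ℝ) := by
  ext Y
  rw [LinearMap.sum_apply]
  exact (sum_apply _ (fun μ => c μ • α μ) ((verticalLift v).symm Y : E)).symm

theorem verticalCovector_injective {v : TQ E Q} {α β : E →L[ℝ] ℝ}
    (h : verticalCovector v α = verticalCovector v β) : α = β := by
  ext w
  have h1 := DFunLike.congr_fun h (verticalLift v w)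
  have h2 : ∀ α : E →L[ℝ] ℝ, verticalCovector v α (verticalLift v w) = α w := fun α =>
    congrArg α ((verticalLift v).symm_apply_apply w)
  rwa [h2, h2] at h1

theorem mem_secondOrderVectors (v : TQ E Q) (X : TangentSpace (modelTQ E) v) :
    X ∈ secondOrderVectors v ↔ (modelVec v X).1 = vec v := by
  rw [secondOrderVectors, mem_ofPred_eq, (hasMFDerivAt_proj v).mfderiv]
  rfl

theorem modelEL_eq (L : TQ E Q → ℝ) (v : TQ E Q) (X : E × E) :
    modelEL L v X = elForm (loc L v.proj) (tqChart v.proj v) X :=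
  eulerLagrange_eq_elForm L v X

/-- With `α` the form of `X₀`, adding the vertical vector `M α` turns it into `α - W M α`, which
`sub_hessSnd_resolution` evaluates. -/
theorem modelEL_D₀ [FiniteDimensional ℝ E] {ι : Type*} [Fintype ι]
    (hL : ContMDiff (modelTQ E) 𝓘(ℝ, ℝ) ∞ L) (hO : IsOpen O)
    {H : CoTQ E Q → ℝ} (hH : ContMDiffOn (modelCoTQ E) 𝓘(ℝ, ℝ) ∞ H O)
    {φ : ι → CoTQ E Q → ℝ} (hφ : ∀ μ, ContMDiffOn (modelCoTQ E) 𝓘(ℝ, ℝ) ∞ (φ μ) O)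
    {U : Set (TQ E Q)} (hU : IsOpen U) (hUO : U ⊆ legendre L ⁻¹' O) {lam : ι → TQ E Q → ℝ}
    (hlam : IsResolution L H φ U lam) (X₀ : ∀ v : TQ E Q, TangentSpace (modelTQ E) v)
    {v : TQ E Q} (hv : v ∈ U) :
    modelEL L v (modelVec v (D₀ L H φ lam X₀ v)) =
      ∑ μ, modelEL L v (modelVec v (X₀ v)) (modelGam L (φ μ) v) • modelDeriv (lam μ) v := by
  have hq := mem_chart_source E v.proj
  have hs : v ∈ (tqChart v.proj).source := mem_tqChart_source.2 hq
  have hz : tqChart v.proj v ∈ (tqChart v.proj).target := (tqChart v.proj).map_source hs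
  have hf := contDiffAt_loc_of_contMDiff hL hz
  have hlamc : ∀ μ, ContDiffAt ℝ ∞ (loc (lam μ) v.proj) (tqChart v.proj v) := fun μ =>
    contDiffAt_loc hU (hlam.smooth μ) hz (by rwa [(tqChart v.proj).left_inv hs])
  have hloc : ∀ μ, loc (lam μ) v.proj (tqChart v.proj v) = lam μ v := fun μ => by
    rw [loc, (tqChart v.proj).left_inv hs]
  have key := sub_hessSnd_resolution hf (contDiffAt_coLoc_legendre hL hO hH hq (hUO hv))
    (fun μ => contDiffAt_coLoc_legendre hL hO (hφ μ) hq (hUO hv)) hlamc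
    (eventually_resolution hL hO hH hφ hU hUO hlam.eq hq hv) (modelEL L v (modelVec v (X₀ v)))
  have hM := toFrame_modelM hL hO hH hφ lam hq (hUO hv) (modelEL L v (modelVec v (X₀ v)))
  rw [toFrame_self, ofFrame_self, ContinuousLinearMap.comp_id, ContinuousLinearMap.id_apply] at hM
  simp only [hloc, ← hM] at key
  have hD : ∀ μ, modelDeriv (lam μ) v = dSnd (loc (lam μ) v.proj) (tqChart v.proj v) := fun μ => by
    rw [modelDeriv_eq_dSnd hq (hlamc μ).differentiableAt_top, toFrame_self,
      ContinuousLinearMap.comp_id]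
  have hE : modelEL L v (modelVec v (D₀ L H φ lam X₀ v)) = modelEL L v (modelVec v (X₀ v)) -
      hessSnd (loc L v.proj) (tqChart v.proj v) (modelM L H φ lam v (modelEL L v (modelVec v (X₀ v)))) := by
    rw [modelEL_eq, D₀_eq, elForm_add_vertical, ← modelEL_eq]
  rw [hE, key]
  exact Finset.sum_congr rfl fun μ _ => by
    rw [hD, modelGam_eq_dCo hL hO (hφ μ) (hUO hv)]

/-- A second-order vector satisfies the constraints `chi` at the points of `V₁`. -/
theorem modelEL_modelGam_eq_zero [FiniteDimensional ℝ E] {ι : Type*} [Fintype ι]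
    (hL : ContMDiff (modelTQ E) 𝓘(ℝ, ℝ) ∞ L) (hO : IsOpen O)
    {φ : ι → CoTQ E Q → ℝ} (hφ : IsIndependentPrimaryConstraints L O φ)
    {v : TQ E Q} (hv : legendre L v ∈ O) (hv₁ : v ∈ primaryLagrangianSubset L)
    {X₀ : TangentSpace (modelTQ E) v} (hX₀ : X₀ ∈ secondOrderVectors v) (μ : ι) :
    modelEL L v (modelVec v X₀) (modelGam L (φ μ) v) = 0 := by
  obtain ⟨X, hX, h0⟩ := hv₁
  rw [mem_secondOrderVectors] at hX hX₀
  have hq := mem_chart_source E v.proj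
  have hz : tqChart v.proj v ∈ (tqChart v.proj).target :=
    (tqChart v.proj).map_source (mem_tqChart_source.2 hq)
  have hf := contDiffAt_loc_of_contMDiff hL hz
  have h1 : modelEL L v (modelVec v X) = 0 := by
    refine verticalCovector_injective (v := v) (h0.trans ?_)
    rfl
  -- Both vectors are second-order, so they differ by a vertical one. As the form vanishes on `X`,
  -- its value on `X₀` is in the image of the hessian, which annihilates `γ_μ`.
  have h2 : (modelVec v X) = (modelVec v X₀) + (0, (modelVec v X).2 - (modelVec v X₀).2) := by
    refine Prod.ext ?_ ?_
    · exact (hX.trans hX₀.symm).trans (add_zero _).symm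
    · exact (add_sub_cancel _ _).symm
  rw [modelEL_eq, h2, elForm_add_vertical, sub_eq_zero] at h1
  rw [modelEL_eq, h1, modelGam_eq_dCo hL hO (hφ.smooth μ) hv]
  exact hessSnd_apply_constraint hf (contDiffAt_coLoc_legendre hL hO (hφ.smooth μ) hq hv)
    (eventually_constraint hL hO hφ hq hv μ) _

/-! ### Smoothness of the dynamical field -/

/-- A vector field on `TQ` is smooth at a point if its components in a natural chart are. -/
theorem contMDiffAt_field_iff (X : ∀ v : TQ E Q, TangentSpace (modelTQ E) v) (v₀ : TQ E Q) :
    ContMDiffAt (modelTQ E) (modelTQ E).tangent ∞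
      (fun v => (⟨v, X v⟩ : TangentBundle (modelTQ E) (TQ E Q))) v₀ ↔
    ContMDiffAt (modelTQ E) 𝓘(ℝ, E × E) ∞
      (fun v => toFrameTQ v₀.proj v (modelVec v (X v))) v₀ :=
  contMDiffAt_section v₀

/-- Smoothness is needed jointly in the point and the vector, in order to insert a vector field. -/
theorem contDiffAt_elForm {f : E × E → ℝ} {z : E × E} (hf : ContDiffAt ℝ ∞ f z) (X : E × E) :
    ContDiffAt ℝ ∞ (fun y : (E × E) × (E × E) => elForm f y.1 y.2) (z, X) := by
  have h1 : ContDiffAt ℝ ∞ (fun y : (E × E) × (E × E) => fderiv ℝ f y.1) (z, X) :=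
    ContDiffAt.comp (g := fderiv ℝ f) (z, X) (hf.fderiv_right (m := ∞) le_rfl) contDiffAt_fst
  have h2 : ContDiffAt ℝ ∞ (fun y : (E × E) × (E × E) => fderiv ℝ (dSnd f) y.1) (z, X) :=
    ContDiffAt.comp (g := fderiv ℝ (dSnd f)) (z, X) (hf.dSnd.fderiv_right (m := ∞) le_rfl)
      contDiffAt_fst
  exact (h1.clm_comp contDiffAt_const).sub (h2.clm_apply contDiffAt_snd)

theorem contDiffAt_add_sum_smul {F G : Type*} [NormedAddCommGroup F] [NormedSpace ℝ F]
    [NormedAddCommGroup G] [NormedSpace ℝ G] {ι : Type*} [Fintype ι] {a : F → G} {c : ι → F → ℝ}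
    {b : ι → F → G} {x : F} (ha : ContDiffAt ℝ ∞ a x) (hc : ∀ μ, ContDiffAt ℝ ∞ (c μ) x)
    (hb : ∀ μ, ContDiffAt ℝ ∞ (b μ) x) :
    ContDiffAt ℝ ∞ (fun y => a y + ∑ μ, c μ y • b μ y) x :=
  ha.add (ContDiffAt.sum fun μ _ => (hc μ).smul (hb μ))

/-- An expression for `D₀` in one chart valid at all nearby points, from which smoothness can be
read. The second-order condition on `X₀` enters because only on such vectors is the Euler-Lagrange
form independent of the chart. -/
theorem toFrameTQ_D₀ [FiniteDimensional ℝ E] {ι : Type*} [Fintype ι]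
    (hL : ContMDiff (modelTQ E) 𝓘(ℝ, ℝ) ∞ L) (hO : IsOpen O)
    {H : CoTQ E Q → ℝ} (hH : ContMDiffOn (modelCoTQ E) 𝓘(ℝ, ℝ) ∞ H O)
    {φ : ι → CoTQ E Q → ℝ} (hφ : ∀ μ, ContMDiffOn (modelCoTQ E) 𝓘(ℝ, ℝ) ∞ (φ μ) O)
    (lam : ι → TQ E Q → ℝ) (X₀ : ∀ v : TQ E Q, TangentSpace (modelTQ E) v)
    {q₀ : Q} {v : TQ E Q} (hq : v.proj ∈ (chartAt E q₀).source) (hv : legendre L v ∈ O)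
    (hX₀ : X₀ v ∈ secondOrderVectors v) :
    toFrameTQ q₀ v (modelVec v (D₀ L H φ lam X₀ v)) = toFrameTQ q₀ v (modelVec v (X₀ v)) +
      (0, (hessCo (coLoc H q₀) (locLegendre (loc L q₀) (tqChart q₀ v)) +
        ∑ μ, loc (lam μ) q₀ (tqChart q₀ v) •
          hessCo (coLoc (φ μ) q₀) (locLegendre (loc L q₀) (tqChart q₀ v)))
        (elForm (loc L q₀) (tqChart q₀ v) (toFrameTQ q₀ v (modelVec v (X₀ v))))) := by
  have hX := (mem_secondOrderVectors v (X₀ v)).1 hX₀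
  have h1 : (modelEL L v (modelVec v (X₀ v))).comp (ofFrame q₀ v.proj) =
      elForm (loc L q₀) (tqChart q₀ v) (toFrameTQ q₀ v (modelVec v (X₀ v))) := by
    ext u
    refine (eulerLagrange_eq_elForm_toFrame hL hq (modelVec v (X₀ v)) hX _).trans ?_
    exact congrArg (elForm (loc L q₀) (tqChart q₀ v) (toFrameTQ q₀ v (modelVec v (X₀ v))))
      (toFrame_ofFrame hq u)
  have h2 : ∀ μ, loc (lam μ) q₀ (tqChart q₀ v) = lam μ v := fun μ =>
    congrArg (lam μ) ((tqChart q₀).left_inv (mem_tqChart_source.2 hq))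
  simp only [h2]
  rw [D₀_eq, map_add, toFrameTQ_vertical hq, toFrame_modelM hL hO hH hφ lam hq hv, h1]

theorem isSecondOrderField_D₀ [FiniteDimensional ℝ E] {ι : Type*} [Fintype ι]
    (hL : ContMDiff (modelTQ E) 𝓘(ℝ, ℝ) ∞ L) (hO : IsOpen O)
    {H : CoTQ E Q → ℝ} (hH : ContMDiffOn (modelCoTQ E) 𝓘(ℝ, ℝ) ∞ H O)
    {φ : ι → CoTQ E Q → ℝ} (hφ : ∀ μ, ContMDiffOn (modelCoTQ E) 𝓘(ℝ, ℝ) ∞ (φ μ) O)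
    {U : Set (TQ E Q)} (hU : IsOpen U) (hUO : U ⊆ legendre L ⁻¹' O) {lam : ι → TQ E Q → ℝ}
    (hlam : ∀ μ, ContMDiffOn (modelTQ E) 𝓘(ℝ, ℝ) ∞ (lam μ) U)
    {X₀ : ∀ v : TQ E Q, TangentSpace (modelTQ E) v} (hX₀ : IsSecondOrderField U X₀) :
    IsSecondOrderField U (D₀ L H φ lam X₀) := by
  refine ⟨fun v₀ hv₀ => ContMDiffAt.contMDiffWithinAt ?_, fun v hv => ?_⟩
  · have hX := (contMDiffAt_field_iff X₀ v₀).1 (hX₀.smooth.contMDiffAt (hU.mem_nhds hv₀))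
    refine (contMDiffAt_field_iff _ v₀).2 ?_
    have hq := mem_chart_source E v₀.proj
    have hs : v₀ ∈ (tqChart v₀.proj).source := mem_tqChart_source.2 hq
    have hz : tqChart v₀.proj v₀ ∈ (tqChart v₀.proj).target := (tqChart v₀.proj).map_source hs
    have hf := contDiffAt_loc_of_contMDiff hL hz
    have ho : IsOpen (tqChart (E := E) v₀.proj).source := isOpen_extChartAt_source _
    have hchart : ContMDiffAt (modelTQ E) 𝓘(ℝ, E × E) ∞ (tqChart v₀.proj) v₀ :=
      (contMDiffOn_tqChart v₀.proj).contMDiffAt (ho.mem_nhds hs)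
    have hlamc : ∀ μ, ContDiffAt ℝ ∞ (loc (lam μ) v₀.proj) (tqChart v₀.proj v₀) := fun μ =>
      contDiffAt_loc hU (hlam μ) hz (by rwa [(tqChart v₀.proj).left_inv hs])
    have hess : ∀ {h : CoTQ E Q → ℝ}, ContMDiffOn (modelCoTQ E) 𝓘(ℝ, ℝ) ∞ h O →
        ContDiffAt ℝ ∞ (fun z => hessCo (coLoc h v₀.proj) (locLegendre (loc L v₀.proj) z))
          (tqChart v₀.proj v₀) := fun hh =>
      (contDiffAt_hessCo (contDiffAt_coLoc_legendre hL hO hh hq (hUO hv₀))).comp _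
        (contDiffAt_locLegendre hf)
    have hM : ContDiffAt ℝ ∞ (fun z => hessCo (coLoc H v₀.proj) (locLegendre (loc L v₀.proj) z) +
        ∑ μ, loc (lam μ) v₀.proj z • hessCo (coLoc (φ μ) v₀.proj) (locLegendre (loc L v₀.proj) z))
        (tqChart v₀.proj v₀) :=
      contDiffAt_add_sum_smul (hess hH) hlamc fun μ => hess (hφ μ)
    -- In the fixed chart, the components of `D₀` are a smooth function of the coordinates of `v`
    -- and the components of `X₀`; composing with the smooth `X₀` gives the claim.
    have hΘ : ContDiffAt ℝ ∞ (fun y : (E × E) × (E × E) => y.2 + ((0 : E),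
        (hessCo (coLoc H v₀.proj) (locLegendre (loc L v₀.proj) y.1) +
        ∑ μ, loc (lam μ) v₀.proj y.1 •
          hessCo (coLoc (φ μ) v₀.proj) (locLegendre (loc L v₀.proj) y.1))
        (elForm (loc L v₀.proj) y.1 y.2)))
        (tqChart v₀.proj v₀, toFrameTQ v₀.proj v₀ (modelVec v₀ (X₀ v₀))) := by
      have hM' := ContDiffAt.comp (f := Prod.fst)
        (tqChart v₀.proj v₀, toFrameTQ v₀.proj v₀ (modelVec v₀ (X₀ v₀))) hM contDiffAt_fst
      exact contDiffAt_snd.add (contDiffAt_const.prodMk (hM'.clm_apply (contDiffAt_elForm hf _)))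
    refine (hΘ.contMDiffAt.comp v₀ (hchart.prodMk_space hX)).congr_of_eventuallyEq ?_
    filter_upwards [ho.mem_nhds hs, hU.mem_nhds hv₀] with v hvs hvU
    exact toFrameTQ_D₀ hL hO hH hφ lam X₀ (mem_tqChart_source.1 hvs) (hUO hvU)
      (hX₀.secondOrder v hvU)
  · rw [mem_secondOrderVectors]
    have h1 := (mem_secondOrderVectors v (X₀ v)).1 (hX₀.secondOrder v hv)
    have h2 := congrArg Prod.fst (D₀_eq L H φ lam X₀ v)
    exact h2.trans ((add_zero _).trans h1)

end

end SingularLagrangian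

open SingularLagrangian
theorem proposition5 {E : Type*} [NormedAddCommGroup E] [NormedSpace ℝ E] [FiniteDimensional ℝ E]
    {Q : Type*} [TopologicalSpace Q] [ChartedSpace E Q] [IsManifold 𝓘(ℝ, E) ∞ Q]
    {ι : Type*} [Fintype ι]
    (L : TQ E Q → ℝ) (hL : ContMDiff (modelTQ E) 𝓘(ℝ, ℝ) ∞ L) (hreg : AlmostRegular L)
    (O : Set (CoTQ E Q)) (hO : IsOpen O)
    (φ : ι → CoTQ E Q → ℝ) (hφ : IsIndependentPrimaryConstraints L O φ)
    (H : CoTQ E Q → ℝ) (hH : IsHamiltonian L O H) :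
    (∃ lam : ι → TQ E Q → ℝ, IsResolution L H φ (legendre L ⁻¹' O) lam) ∧
    ∀ (U : Set (TQ E Q)), IsOpen U → U ⊆ legendre L ⁻¹' O →
      ∀ lam : ι → TQ E Q → ℝ, IsResolution L H φ U lam →
      ∀ X₀ : (∀ v : TQ E Q, TangentSpace (modelTQ E) v), IsSecondOrderField U X₀ →
        IsPrimaryField L U (D₀ L H φ lam X₀) ∧
        (∀ v ∈ U, eulerLagrangeHat L v (D₀ L H φ lam X₀ v) =
          ∑ μ, chi L (φ μ) X₀ v • verticalCovector v (fibreDeriv (lam μ) v)) ∧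
        ∀ v ∈ primaryLagrangianSubset L ∩ U,
          ∑ μ, chi L (φ μ) X₀ v • verticalCovector v (fibreDeriv (lam μ) v) = 0 := by
  refine ⟨exists_isResolution hL hreg hO hφ hH, fun U hU hUO lam hlam X₀ hX₀ => ?_⟩
  have h1 : ∀ v ∈ U, eulerLagrangeHat L v (D₀ L H φ lam X₀ v) =
      ∑ μ, chi L (φ μ) X₀ v • verticalCovector v (fibreDeriv (lam μ) v) := fun v hv => by
    have h := modelEL_D₀ hL hO hH.smooth hφ.smooth hU hUO hlam X₀ hv
    simp only [← chi_eq] at h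
    exact (congrArg (verticalCovector v) h).trans
      (sum_smul_verticalCovector v (fun μ => chi L (φ μ) X₀ v) fun μ => modelDeriv (lam μ) v).symm
  have h2 : ∀ v ∈ primaryLagrangianSubset L ∩ U,
      ∑ μ, chi L (φ μ) X₀ v • verticalCovector v (fibreDeriv (lam μ) v) = 0 := fun v hv => by
    refine Finset.sum_eq_zero fun μ _ => ?_
    rw [chi_eq, modelEL_modelGam_eq_zero hL hO hφ (hUO hv.2) hv.1 (hX₀.secondOrder v hv.2),
      zero_smul]
  exact ⟨⟨isSecondOrderField_D₀ hL hO hH.smooth hφ.smooth hU hUO hlam.smooth hX₀,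
    fun v hv => (h1 v hv.2).trans (h2 v hv)⟩, h1, h2⟩
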